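/- **Constraints and the problem.** A *constraint* of arity $k$ is a function $h:\{0,1\}^k\to\mathbb R^{\ge 0}$. For a (finite or infinite) set $\mathcal F$ of constraints, MAX-PROD-CSP$(\mathcal F)$ is the following maximization problem. An instance consists of a number $n$ of Boolean variables $x_1,\dots,x_n$ and a finite set $H$ of pairs $\langle h,(x_{i_1},\dots,x_{i_k})\rangle$ with $h\in\mathcal F$ of arity $k$ and $i_1,\dots,i_k\in\{1,\dots,n\}$. The solutions are the assignments $\sigma:\{x_1,\dots,x_n\}\to\{0,1\}$. The measure of $\sigma$ is $\prod_{\langle h,(x_{i_1},\dots,x_{i_k})\rangle\in H}h(\sigma(x_{i_1}),\dots,\sigma(x_{i_k}))$. **Computation.** Since weights are arbitrary real numbers, algorithms are programs of a random access machine over the reals: finitely many registers and stacks of reals, rational constants, and one step for each exact operation $+,-,\times,\div$, comparison, push or pop, fair coin flip, or oracle call. Instances are finite words of real numbers, and the size $|x|$ of an instance is the length of its word. In an instance of MAX-PROD-CSP$(\mathcal F)$ the number $n$ is written in unary, and each element of $H$ is written as its arity, its variable indices and the table of the $2^k$ values of $h$ in lexicographic order. Solutions are binary words. **Optimization problems.**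 An optimization problem $P=(I,\mathrm{sol},m)$ has a set $I$ of instances, for each $x\in I$ a set $\mathrm{sol}(x)$ of solutions, a measure $m(x,y)\ge 0$ for $y\in\mathrm{sol}(x)$, and a goal (max or min); $m^*(x)$ is the optimum. For $r\ge1$, a solution $y\in \mathrm{sol}(x)$ is $r$-*approximate* if $1/r\le m(x,y)/m^*(x)\le r$, or, in case $m^*(x)=0$, if $m(x,y)=0$. $P$ is in NPO if instances and solutions are recognized in deterministic polynomial time, solutions have length polynomially bounded in $|x|$, and $m$ is computed in deterministic polynomial time. EXP-APX is the class of all $P$ in NPO for which there are a function $\alpha$ and a polynomial $p$ with $1\le\alpha(n)\le 2^{p(n)}$ for all $n\in\mathbb N$, and a deterministic polynomial-time algorithm that on every $x\in I$ outputs an $\alpha(|x|)$-approximate solution. **Reductions.** A *randomized approximation scheme* for $P$ is a randomized procedure that on every $(x,\varepsilon)\in I\times(0,1)$ outputs a $2^{\varepsilon}$-approximate solution with probability at least $3/4$. $P$ is *APT-reducible* to $Q=(I',\mathrm{sol}',m')$ if there are a randomized oracle program $N$ and polynomials $p,q$ such that, for every randomized approximation scheme $M$ for $Q$ (not necessarily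 efficient, nor even computable) used as oracle, with an independent outcome of $M$ for each call: (i) $N$ is a randomized approximation scheme for $P$; (ii) on input $(x,\varepsilon)$, every oracle call is of the form $(w,\delta)\in I'\times(0,1)$ with $1/\delta\le p(|x|,1/\varepsilon)$; (iii) on input $(x,\varepsilon)$, $N$ always halts within $q(|x|,1/\varepsilon)$ steps. **Lemma.** For every constraint set $\mathcal F$ there is a problem $Q$ in EXP-APX such that MAX-PROD-CSP$(\mathcal F)$ is APT-reducible to $Q$. -/

import Mathlib

open scoped NNReal ENNReal

noncomputable section

namespace MaxProd

/-! ## The model of computation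

Constraint weights are arbitrary nonnegative reals, so algorithms are programs of a random access
machine over the reals.  A program uses finitely many registers, each holding one real, and finitely
many stacks of reals.  Exact rational operations and comparisons of two registers, one push, one
pop, one coin flip and one oracle call each take one step.  The size of a word of reals is its
length.  The only constants of a program are rational. -/

/-- The memory of the machine. -/
structure Store where
  reg : ℕ → ℝ
  stk : ℕ → List ℝ

/-- Elementary deterministic instructions; registers and stacks are addressed by fixed numbers. -/
inductive Instr where
  | const (r : ℕ) (q : ℚ)
  | copy (r a : ℕ)
  | add (r a b : ℕ)
  | sub (r a b : ℕ)
  | mul (r a b : ℕ)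
  | div (r a b : ℕ)
  | push (k a : ℕ)
  | pop (r k : ℕ)

/-- The effect of an elementary instruction.  Dividing by zero and popping an empty stack both
yield the value `0`. -/
def Instr.exec : Instr → Store → Store
  | .const r q, s => { s with reg := Function.update s.reg r (q : ℝ) }
  | .copy r a, s => { s with reg := Function.update s.reg r (s.reg a) }
  | .add r a b, s => { s with reg := Function.update s.reg r (s.reg a + s.reg b) }
  | .sub r a b, s => { s with reg := Function.update s.reg r (s.reg a - s.reg b) }
  | .mul r a b, s => { s with reg := Function.update s.reg r (s.reg a * s.reg b) }
  | .div r a b, s => { s with reg := Function.update s.reg r (s.reg a / s.reg b) }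
  | .push k a, s => { s with stk := Function.update s.stk k (s.reg a :: s.stk k) }
  | .pop r k, s =>
      { reg := Function.update s.reg r ((s.stk k).headD 0)
        stk := Function.update s.stk k (s.stk k).tail }

/-- Tests for branching. -/
inductive Test where
  | le (a b : ℕ)
  | empty (k : ℕ)
  | neg (t : Test)

def Test.Holds : Test → Store → Prop
  | .le a b, s => s.reg a ≤ s.reg b
  | .empty k, s => s.stk k = []
  | .neg t, s => ¬ t.Holds s

/-- Programs.  `flip r` puts a fair random bit into register `r`.  `query k d a` asks the oracle
about the word on stack `k` with the error tolerance in register `d`, and writes the answer onto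
stack `a` in place of its former contents. -/
inductive Prog where
  | skip
  | instr (i : Instr)
  | flip (r : ℕ)
  | query (k d a : ℕ)
  | seq (P Q : Prog)
  | ite (t : Test) (P Q : Prog)
  | loop (t : Test) (P : Prog)

/-- A program that neither flips coins nor asks the oracle. -/
def Prog.Deterministic : Prog → Prop
  | .skip => True
  | .instr _ => True
  | .flip _ => False
  | .query _ _ _ => False
  | .seq P Q => P.Deterministic ∧ Q.Deterministic
  | .ite _ P Q => P.Deterministic ∧ Q.Deterministic
  | .loop _ P => P.Deterministic

/-- An oracle: for every word and every tolerance, a distribution of answers.  Every call draws a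
fresh, independent answer. -/
abbrev Oracle := List ℝ → ℝ → PMF (List ℝ)

/-- A configuration: the list of programs still to be executed, and the memory. -/
structure Cfg where
  todo : List Prog
  store : Store

open Classical in
/-- One step of the machine.  A configuration with nothing left to execute has halted. -/
def step (O : Oracle) : Cfg → PMF Cfg
  | ⟨[], s⟩ => PMF.pure ⟨[], s⟩
  | ⟨.skip :: K, s⟩ => PMF.pure ⟨K, s⟩
  | ⟨.instr i :: K, s⟩ => PMF.pure ⟨K, i.exec s⟩
  | ⟨.flip r :: K, s⟩ =>
      (PMF.uniformOfFintype Bool).map fun b =>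
        ⟨K, { s with reg := Function.update s.reg r (if b then 1 else 0) }⟩
  | ⟨.query k d a :: K, s⟩ =>
      (O (s.stk k) (s.reg d)).map fun w => ⟨K, { s with stk := Function.update s.stk a w }⟩
  | ⟨.seq P Q :: K, s⟩ => PMF.pure ⟨P :: Q :: K, s⟩
  | ⟨.ite t P Q :: K, s⟩ => PMF.pure (if t.Holds s then ⟨P :: K, s⟩ else ⟨Q :: K, s⟩)
  | ⟨.loop t P :: K, s⟩ => PMF.pure (if t.Holds s then ⟨P :: .loop t P :: K, s⟩ else ⟨K, s⟩)

/-- The distribution of the configuration after a given number of steps. -/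
def run (O : Oracle) : ℕ → Cfg → PMF Cfg
  | 0, c => PMF.pure c
  | t + 1, c => (step O c).bind (run O t)

/-- The memory at the start: `x` on stack `0`, `y` on stack `1`, `e` in register `0`, all other
stacks empty and all other registers `0`. -/
def load (x y : List ℝ) (e : ℝ) : Store where
  reg := fun r => if r = 0 then e else 0
  stk := fun k => if k = 0 then x else if k = 1 then y else []

/-- Every computation path from memory `s` halts within `t` steps, in a memory satisfying `Post`. -/
def HaltsWithin (O : Oracle) (P : Prog) (s : Store) (t : ℕ) (Post : Store → Prop) : Prop :=
  ∀ c ∈ (run O t ⟨[P], s⟩).support, c.todo = [] ∧ Post c.store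

/-- The trivial oracle, used where programs make no oracle calls. -/
def noOracle : Oracle := fun _ _ => PMF.pure []

/-- A binary word as a word of reals. -/
def bits (y : List Bool) : List ℝ := y.map fun b => if b then 1 else 0

/-! ## Optimization problems -/

inductive Goal where
  | maximize
  | minimize

/-- A combinatorial optimization problem.  Instances are presented to algorithms as words of reals,
solutions are binary words.  The values of the measure outside `sol X` play no role. -/
structure OptProblem where
  Inst : Type
  encode : Inst → List ℝ
  encode_injective : Function.Injective encode
  sol : Inst → Set (List Bool)
  measure : Inst → List Bool → ℝ≥0
  goal : Goal

namespace OptProblem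

/-- The size of an instance. -/
def size (P : OptProblem) (X : P.Inst) : ℕ := (P.encode X).length

def IsOptimal (P : OptProblem) (X : P.Inst) (y : List Bool) : Prop :=
  y ∈ P.sol X ∧
    match P.goal with
    | .maximize => ∀ z ∈ P.sol X, P.measure X z ≤ P.measure X y
    | .minimize => ∀ z ∈ P.sol X, P.measure X y ≤ P.measure X z

/-- `y` is an `r`-approximate solution for `X`. -/
def IsApprox (P : OptProblem) (r : ℝ) (X : P.Inst) (y : List Bool) : Prop :=
  y ∈ P.sol X ∧ ∃ z, P.IsOptimal X z ∧
    (P.measure X z = 0 → P.measure X y = 0) ∧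
    (P.measure X z ≠ 0 →
      1 / r ≤ |(P.measure X y : ℝ) / P.measure X z| ∧ |(P.measure X y : ℝ) / P.measure X z| ≤ r)

/-- The class NPO. -/
structure InNPO (P : OptProblem) : Prop where
  /-- instances are recognized in polynomial time -/
  inst_rec : ∃ A : Prog, A.Deterministic ∧ ∃ p : Polynomial ℕ, ∀ w : List ℝ,
    HaltsWithin noOracle A (load w [] 0) (p.eval w.length)
      fun s => s.reg 0 = 1 ↔ w ∈ Set.range P.encode
  /-- solutions are recognized in polynomial time -/
  sol_rec : ∃ A : Prog, A.Deterministic ∧ ∃ p : Polynomial ℕ, ∀ (X : P.Inst) (y : List Bool),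
    HaltsWithin noOracle A (load (P.encode X) (bits y) 0) (p.eval (P.size X + y.length))
      fun s => s.reg 0 = 1 ↔ y ∈ P.sol X
  /-- solutions are polynomially bounded -/
  sol_bound : ∃ p : Polynomial ℕ, ∀ (X : P.Inst), ∀ y ∈ P.sol X, y.length ≤ p.eval (P.size X)
  /-- the measure is computed in polynomial time -/
  measure_comp : ∃ A : Prog, A.Deterministic ∧ ∃ p : Polynomial ℕ,
    ∀ (X : P.Inst), ∀ y ∈ P.sol X,
      HaltsWithin noOracle A (load (P.encode X) (bits y) 0) (p.eval (P.size X + y.length))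
        fun s => s.reg 0 = P.measure X y

/-- There is a deterministic polynomial-time `α`-approximation algorithm, with output on
stack `1`. -/
def HasApproxAlgorithm (P : OptProblem) (α : ℕ → ℝ) : Prop :=
  ∃ A : Prog, A.Deterministic ∧ ∃ p : Polynomial ℕ, ∀ X : P.Inst,
    HaltsWithin noOracle A (load (P.encode X) [] 0) (p.eval (P.size X))
      fun s => ∃ y, s.stk 1 = bits y ∧ P.IsApprox (α (P.size X)) X y

/-- The class EXP-APX. -/
def EXPAPX : Set OptProblem :=
  {P | P.InNPO ∧ ∃ α : ℕ → ℝ,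
    (∃ p : Polynomial ℕ, ∀ n, 1 ≤ α n ∧ α n ≤ 2 ^ (p.eval n)) ∧ P.HasApproxAlgorithm α}

/-- `D`, given by its distribution of outputs on every instance and tolerance, is a randomized
approximation scheme. -/
def IsRandomizedScheme (P : OptProblem) (D : P.Inst → ℝ → PMF (List ℝ)) : Prop :=
  ∀ (X : P.Inst) (ε : ℝ), 0 < ε → ε < 1 →
    3 / 4 ≤ (D X ε).toOuterMeasure {w | ∃ y, w = bits y ∧ P.IsApprox ((2 : ℝ) ^ ε) X y}

/-- The value of a bivariate polynomial at `(|X|, 1/ε)`. -/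
def polyVal (P : OptProblem) (p : MvPolynomial (Fin 2) ℕ) (X : P.Inst) (ε : ℝ) : ℝ :=
  MvPolynomial.aeval ![(P.size X : ℝ), 1 / ε] p

/-- `P` is APT-reducible to `Q`: a randomized oracle program `N`, started with the encoding of `X`
on stack `0` and `ε` in register `0` and leaving its output on stack `1`, is a randomized
approximation scheme for `P`, whichever randomized approximation scheme for `Q` is its oracle.
The polynomials `p` (for the tolerances of oracle calls) and `q` (for the running time) do not
depend on the oracle. -/
def APTReduces (P Q : OptProblem) : Prop :=
  ∃ (N : Prog) (p q : MvPolynomial (Fin 2) ℕ), ∀ O : Oracle,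
    Q.IsRandomizedScheme (fun Y δ => O (Q.encode Y) δ) →
      P.IsRandomizedScheme (fun X ε =>
        (run O ⌊P.polyVal q X ε⌋₊ ⟨[N], load (P.encode X) [] ε⟩).map fun c => c.store.stk 1) ∧
      ∀ (X : P.Inst) (ε : ℝ), 0 < ε → ε < 1 →
        (∀ t, ∀ c ∈ (run O t ⟨[N], load (P.encode X) [] ε⟩).support,
          ∀ k d a K, c.todo = Prog.query k d a :: K →
            c.store.stk k ∈ Set.range Q.encode ∧
            0 < c.store.reg d ∧ c.store.reg d < 1 ∧ 1 / c.store.reg d ≤ P.polyVal p X ε) ∧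
        HaltsWithin O N (load (P.encode X) [] ε) ⌊P.polyVal q X ε⌋₊ fun _ => True

/-- `P` is APT-reducible to some problem of the class `C`. -/
def APTReducesToClass (P : OptProblem) (C : Set OptProblem) : Prop :=
  ∃ Q ∈ C, P.APTReduces Q

end OptProblem

/-! ## MAX-PROD-CSP -/

/-- A nonnegative-real-weighted Boolean constraint. -/
structure Constraint where
  arity : ℕ
  val : (Fin arity → Bool) → ℝ≥0

/-- The values of a function on `{0,1}^k` in lexicographic order. -/
def table : (k : ℕ) → ((Fin k → Bool) → ℝ≥0) → List ℝ
  | 0, f => [(f Fin.elim0 : ℝ)]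
  | k + 1, f =>
      table k (fun v => f (Fin.cons false v)) ++ table k (fun v => f (Fin.cons true v))

/-- A constraint together with the variables (out of `n`) to which it is applied. -/
structure App (n : ℕ) where
  con : Constraint
  args : Fin con.arity → Fin n

/-- An application is written as its arity, its variable indices and its table of values. -/
def App.encode {n : ℕ} (a : App n) : List ℝ :=
  (a.con.arity : ℝ) :: (List.ofFn (fun i => ((a.args i : ℕ) : ℝ)) ++ table a.con.arity a.con.val)

/-- An instance of MAX-PROD-CSP(F): a finite set of applications of constraints of `F`, listed
without repetition. -/
structure CSPInst (F : Set Constraint) where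
  numVars : ℕ
  apps : List (App numVars)
  nodup : apps.Nodup
  mem : ∀ a ∈ apps, a.con ∈ F

/-- The number of variables is written in unary, so that the size is at least that number. -/
def CSPInst.encode {F : Set Constraint} (X : CSPInst F) : List ℝ :=
  List.replicate X.numVars 1 ++ 0 :: X.apps.flatMap App.encode

/-- The objective value of an assignment, given as a binary word. -/
def CSPInst.value {F : Set Constraint} (X : CSPInst F) (y : List Bool) : ℝ≥0 :=
  (X.apps.map fun a => a.con.val fun i => y.getD (a.args i) false).prod

theorem table_length (k : ℕ) (f : (Fin k → Bool) → ℝ≥0) : (table k f).length = 2 ^ k := by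
  induction k with
  | zero => simp [table]
  | succ k ih => simp [table, ih, pow_succ, mul_two]

theorem table_injective (k : ℕ) : Function.Injective (table k) := by
  induction k with
  | zero =>
    intro f g h
    funext v
    have hv : v = Fin.elim0 := Subsingleton.elim _ _
    subst hv
    simpa [table] using h
  | succ k ih =>
    intro f g h
    obtain ⟨h0, h1⟩ := List.append_inj h (by simp [table_length])
    funext v
    rw [← Fin.cons_self_tail v]
    cases v 0
    · exact congrFun (ih h0) (Fin.tail v)
    · exact congrFun (ih h1) (Fin.tail v)

theorem App.encode_append_inj {n : ℕ} {a b : App n} {u v : List ℝ}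
    (h : a.encode ++ u = b.encode ++ v) : a = b ∧ u = v := by
  obtain ⟨⟨k, f⟩, s⟩ := a
  obtain ⟨⟨l, g⟩, t⟩ := b
  simp only [App.encode, List.cons_append, List.cons.injEq, Nat.cast_inj, List.append_assoc] at h
  obtain ⟨rfl, h⟩ := h
  obtain ⟨h1, h⟩ := List.append_inj h (by simp)
  obtain ⟨h2, h3⟩ := List.append_inj h (by simp [table_length])
  have hf : f = g := table_injective _ h2
  have hs : s = t := by
    funext i
    have := congrFun (List.ofFn_injective h1) i
    exact Fin.ext (by exact_mod_cast this)
  subst hf hs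
  exact ⟨rfl, h3⟩

theorem App.flatMap_encode_injective {n : ℕ} :
    Function.Injective fun l : List (App n) => l.flatMap App.encode := by
  intro l
  induction l with
  | nil =>
    rintro (_ | ⟨b, m⟩) h
    · rfl
    · simp [App.encode] at h
  | cons a l ih =>
    rintro (_ | ⟨b, m⟩) h
    · simp [App.encode] at h
    · simp only [List.flatMap_cons] at h
      obtain ⟨rfl, h'⟩ := App.encode_append_inj h
      rw [ih h']

theorem replicate_append_inj (n : ℕ) : ∀ (m : ℕ) (u v : List ℝ),
    List.replicate n (1 : ℝ) ++ 0 :: u = List.replicate m 1 ++ 0 :: v → n = m ∧ u = v := by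
  induction n with
  | zero =>
    rintro (_ | m) u v h
    · simpa using h
    · simp [List.replicate_succ] at h
  | succ n ih =>
    rintro (_ | m) u v h
    · simp [List.replicate_succ] at h
    · simp only [List.replicate_succ, List.cons_append, List.cons.injEq, true_and] at h
      obtain ⟨rfl, h'⟩ := ih m u v h
      exact ⟨rfl, h'⟩

theorem CSPInst.encode_injective (F : Set Constraint) :
    Function.Injective (CSPInst.encode (F := F)) := by
  rintro ⟨n, l, hl, hF⟩ ⟨m, l', hl', hF'⟩ h
  obtain ⟨h1, h2⟩ := replicate_append_inj _ _ _ _ h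
  dsimp only at h1
  subst h1
  have := App.flatMap_encode_injective h2
  dsimp only at this
  subst this
  rfl

/-- The maximization problem MAX-PROD-CSP(F). -/
def maxProdCSP (F : Set Constraint) : OptProblem where
  Inst := CSPInst F
  encode := CSPInst.encode
  encode_injective := CSPInst.encode_injective F
  sol := fun X => {y | y.length = X.numVars}
  measure := CSPInst.value
  goal := .maximize

end MaxProd

end

/-!
To improve the current assignment, ask the oracle for an assignment whose value exceeds that of the
current one and which passes random parity checks.  In the target problem an assignment with a value
above the threshold has measure `2 ^ (j + 1)`, where `j` is the number of checks that it passes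
before its first failure, and all others have measure `1`.  As the measures are powers of `2`, an
answer within a factor `2 ^ (1 / 2)` of the optimum is an optimal one.  The measures are at most
exponential in the length of the instance, so the target problem is in EXP-APX, however large or
small the weights are.

If there are `N` better assignments, then by the pairwise independence of the checks (Valiant and
Vazirani) each of them is with probability at least `1 / (8 N)` the only one to pass the first
`log N + 2` checks, and is then the answer.  So, up to failures of the oracle, the current
assignment moves to a nearly uniform better one with constant probability, and the expected number
of better assignments shrinks by the factor `61 / 64` in each round.  After `16 (n + 2)` rounds it
is at most `1 / 4`, and by Markov's inequality the current assignment is then optimal with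
probability at least `3 / 4`.
-/

noncomputable section

namespace MaxProd

/-! ## Means -/

/-- The mean of `f` under the distribution `p`. -/
def mean {α : Type*} (p : PMF α) (f : α → ℝ≥0∞) : ℝ≥0∞ := ∑' a, p a * f a

section

variable {α β : Type*}

theorem mean_pure (a : α) (f : α → ℝ≥0∞) : mean (PMF.pure a) f = f a := by
  rw [mean, tsum_eq_single a fun b hb => by simp [hb]]
  simp

theorem mean_bind (p : PMF α) (q : α → PMF β) (f : β → ℝ≥0∞) :
    mean (p.bind q) f = mean p fun a => mean (q a) f := by
  simp only [mean, PMF.bind_apply, ← ENNReal.tsum_mul_right, ← ENNReal.tsum_mul_left, mul_assoc]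
  exact ENNReal.tsum_comm

theorem mean_map (p : PMF α) (g : α → β) (f : β → ℝ≥0∞) :
    mean (p.map g) f = mean p (f ∘ g) := by
  rw [← PMF.bind_pure_comp, mean_bind]
  simp only [Function.comp_apply, mean_pure]
  rfl

theorem mean_mono_of_mem_support (p : PMF α) {f g : α → ℝ≥0∞} (h : ∀ a ∈ p.support, f a ≤ g a) :
    mean p f ≤ mean p g := by
  refine ENNReal.tsum_le_tsum fun a => ?_
  by_cases ha : p a = 0
  · simp [ha]
  · gcongr
    exact h a ((p.mem_support_iff a).2 ha)

theorem mean_mono (p : PMF α) {f g : α → ℝ≥0∞} (h : ∀ a, f a ≤ g a) : mean p f ≤ mean p g :=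
  mean_mono_of_mem_support p fun a _ => h a

theorem mean_const (p : PMF α) (c : ℝ≥0∞) : mean p (fun _ => c) = c := by
  rw [mean, ENNReal.tsum_mul_right, p.tsum_coe, one_mul]

theorem mean_add (p : PMF α) (f g : α → ℝ≥0∞) :
    (mean p fun a => f a + g a) = mean p f + mean p g := by
  simp only [mean, mul_add, ENNReal.tsum_add]

theorem mean_mul_left (p : PMF α) (c : ℝ≥0∞) (f : α → ℝ≥0∞) :
    (mean p fun a => c * f a) = c * mean p f := by
  simp only [mean, mul_left_comm _ c, ENNReal.tsum_mul_left]

theorem mean_uniform [Fintype α] [Nonempty α] (f : α → ℝ≥0∞) :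
    mean (PMF.uniformOfFintype α) f = (Fintype.card α : ℝ≥0∞)⁻¹ * ∑ a, f a := by
  simp only [mean, PMF.uniformOfFintype_apply, tsum_fintype, Finset.mul_sum]

theorem mean_indicator (p : PMF α) (A : Set α) : mean p (A.indicator 1) = p.toOuterMeasure A := by
  rw [PMF.toOuterMeasure_apply]
  refine tsum_congr fun a => ?_
  by_cases ha : a ∈ A <;> simp [ha]

theorem one_le_of_one_le_mean {p : PMF α} {f : α → ℝ≥0∞} (hf : ∀ a, f a ≤ 1)
    (h : 1 ≤ mean p f) {a : α} (ha : a ∈ p.support) : 1 ≤ f a := by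
  by_contra! hlt
  have h_le (b : α) : p b * f b ≤ p b := mul_le_of_le_one_right' (hf b)
  have h_lt : p a * f a < p a := by
    simpa using (ENNReal.mul_lt_mul_iff_right ((p.mem_support_iff a).1 ha) (p.apply_ne_top a)).2 hlt
  have h_sum : mean p f < ∑' b, p b :=
    ENNReal.tsum_lt_tsum
      (((ENNReal.tsum_le_tsum h_le).trans_lt (by simp [p.tsum_coe])).ne) h_le h_lt
  rw [p.tsum_coe] at h_sum
  exact h.not_gt h_sum

end

/-! ## Expectations along a computation -/

/-- A pending oracle call with a tolerance other than `1 / 2`. -/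
def BadQuery (c : Cfg) : Prop :=
  ∃ k d a K, c.todo = Prog.query k d a :: K ∧ c.store.reg d ≠ 1 / 2

open Classical in
/-- The expectation of `ψ` over the final memories of the paths that halt within `t` steps and
ask the oracle with tolerance `1 / 2` only. -/
def expect (O : Oracle) (ψ : Store → ℝ≥0∞) : ℕ → Cfg → ℝ≥0∞
  | 0, c => if c.todo = [] then ψ c.store else 0
  | t + 1, c => if BadQuery c then 0 else mean (step O c) (expect O ψ t)

section

variable {O : Oracle} {ψ : Store → ℝ≥0∞}

theorem expect_succ {c : Cfg} (hc : ¬ BadQuery c) (t : ℕ) :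
    expect O ψ (t + 1) c = mean (step O c) (expect O ψ t) := if_neg hc

theorem expect_succ_of_step {c c' : Cfg} (hc : ¬ BadQuery c) (h : step O c = PMF.pure c') (t : ℕ) :
    expect O ψ (t + 1) c = expect O ψ t c' := by
  rw [expect_succ hc, h, mean_pure]

theorem expect_halted (t : ℕ) (s : Store) : expect O ψ t ⟨[], s⟩ = ψ s := by
  induction t with
  | zero => simp [expect]
  | succ t ih => rw [expect_succ_of_step (by simp [BadQuery]) rfl, ih]

theorem expect_le_succ (t : ℕ) (c : Cfg) : expect O ψ t c ≤ expect O ψ (t + 1) c := by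
  induction t generalizing c with
  | zero =>
    obtain ⟨todo, s⟩ := c
    cases todo with
    | nil => simp [expect_halted]
    | cons P K => simp [expect]
  | succ t ih =>
    rw [expect, expect]
    split_ifs
    · exact le_rfl
    · exact mean_mono _ ih

theorem expect_mono (c : Cfg) : Monotone fun t => expect O ψ t c :=
  monotone_nat_of_le_succ fun t => expect_le_succ t c

theorem expect_le_one (hψ : ∀ s, ψ s ≤ 1) (t : ℕ) (c : Cfg) : expect O ψ t c ≤ 1 := by
  induction t generalizing c with
  | zero =>
    rw [expect]
    split_ifs
    exacts [hψ _, zero_le_one]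
  | succ t ih =>
    rw [expect]
    split_ifs
    exacts [zero_le_one, (mean_mono _ ih).trans_eq (mean_const _ 1)]

theorem halted_of_one_le_expect (hψ : ∀ s, ψ s ≤ 1) {t : ℕ} {c : Cfg}
    (h : 1 ≤ expect O ψ t c) : ∀ c' ∈ (run O t c).support, c'.todo = [] ∧ 1 ≤ ψ c'.store := by
  induction t generalizing c with
  | zero =>
    intro c' hc'
    obtain rfl : c' = c := by simpa [run] using hc'
    rw [expect] at h
    split_ifs at h with h0
    · exact ⟨h0, h⟩
    · simp at h
  | succ t ih =>
    intro c' hc'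
    rw [expect] at h
    split_ifs at h with h0
    · simp at h
    · rw [run, PMF.mem_support_bind_iff] at hc'
      obtain ⟨d, hd, hc'⟩ := hc'
      exact ih (one_le_of_one_le_mean (expect_le_one hψ t) h hd) c' hc'

theorem not_badQuery_of_one_le_expect (hψ : ∀ s, ψ s ≤ 1) {t : ℕ} {c : Cfg}
    (h : 1 ≤ expect O ψ t c) (u : ℕ) : ∀ c' ∈ (run O u c).support, ¬ BadQuery c' := by
  have h' : 1 ≤ expect O ψ (t + u + 1) c := h.trans (expect_mono c (by lia))
  clear h
  induction u generalizing c with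
  | zero =>
    intro c' hc' hbad
    obtain rfl : c' = c := by simpa [run] using hc'
    rw [expect, if_pos hbad] at h'
    simp at h'
  | succ u ih =>
    intro c' hc'
    rw [expect] at h'
    split_ifs at h' with h0
    · simp at h'
    · rw [run, PMF.mem_support_bind_iff] at hc'
      obtain ⟨d, hd, hc'⟩ := hc'
      exact ih (one_le_of_one_le_mean (expect_le_one hψ _) h' hd) c' hc'

theorem expect_indicator_le (A : Set Store) (t : ℕ) (c : Cfg) :
    expect O (A.indicator 1) t c ≤ (run O t c).toOuterMeasure {c' | c'.store ∈ A} := by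
  classical
  induction t generalizing c with
  | zero =>
    rw [expect, run, PMF.toOuterMeasure_pure_apply, Set.indicator_apply]
    simp only [Set.mem_ofPred_eq]
    split_ifs <;> simp
  | succ t ih =>
    rw [expect, run, PMF.toOuterMeasure_bind_apply]
    split_ifs
    · simp
    · exact mean_mono _ ih

end

/-! ## Executions -/

/-- The registers that an instruction may overwrite. -/
def Instr.regs : Instr → List ℕ
  | .const r _ | .copy r _ | .add r _ _ | .sub r _ _ | .mul r _ _ | .div r _ _ | .pop r _ => [r]
  | .push _ _ => []

/-- The stacks that an instruction may alter. -/
def Instr.stks : Instr → List ℕ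
  | .const _ _ | .copy _ _ | .add _ _ _ | .sub _ _ _ | .mul _ _ _ | .div _ _ _ => []
  | .push k _ | .pop _ k => [k]

/-- The registers that a program may overwrite. -/
def Prog.regs : Prog → List ℕ
  | .skip | .query _ _ _ => []
  | .instr i => i.regs
  | .flip r => [r]
  | .seq P Q | .ite _ P Q => P.regs ++ Q.regs
  | .loop _ P => P.regs

/-- The stacks that a program may alter. -/
def Prog.stks : Prog → List ℕ
  | .skip | .flip _ => []
  | .instr i => i.stks
  | .query _ _ a => [a]
  | .seq P Q | .ite _ P Q => P.stks ++ Q.stks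
  | .loop _ P => P.stks

/-- The memories `s` and `s'` agree wherever the text of `P` shows that `P` does not write. -/
structure Prog.Frame (P : Prog) (s s' : Store) : Prop where
  reg : ∀ r, (_ : r ∉ P.regs := by decide) → s'.reg r = s.reg r
  stk : ∀ k, (_ : k ∉ P.stks := by decide) → s'.stk k = s.stk k

theorem Prog.Frame.refl (P : Prog) (s : Store) : P.Frame s s := ⟨fun _ _ => rfl, fun _ _ => rfl⟩

theorem Prog.Frame.instr (i : Instr) (s : Store) : (Prog.instr i).Frame s (i.exec s) := by
  cases i <;> constructor <;> intro _ h <;>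
    simp_all [Instr.exec, Prog.regs, Prog.stks, Instr.regs, Instr.stks]

theorem Prog.Frame.trans {P : Prog} {s₁ s₂ s₃ : Store} (h : P.Frame s₁ s₂)
    (h' : P.Frame s₂ s₃) : P.Frame s₁ s₃ :=
  ⟨fun r hr => (h'.reg r hr).trans (h.reg r hr), fun k hk => (h'.stk k hk).trans (h.stk k hk)⟩

theorem Prog.Frame.weaken {P Q : Prog} {s s' : Store} (h : P.Frame s s')
    (hr : P.regs ⊆ Q.regs) (hk : P.stks ⊆ Q.stks) : Q.Frame s s' :=
  ⟨fun r h' => h.reg r fun hP => h' (hr hP), fun k h' => h.stk k fun hP => h' (hk hP)⟩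

theorem Prog.Frame.seq {P Q : Prog} {s₁ s₂ s₃ : Store} (hP : P.Frame s₁ s₂)
    (hQ : Q.Frame s₂ s₃) : (P.seq Q).Frame s₁ s₃ :=
  (hP.weaken (List.subset_append_left _ _) (List.subset_append_left _ _)).trans
    (hQ.weaken (List.subset_append_right _ _) (List.subset_append_right _ _))

theorem Prog.Frame.ite_left {b : Test} {P Q : Prog} {s s' : Store} (h : P.Frame s s') :
    (Prog.ite b P Q).Frame s s' :=
  h.weaken (List.subset_append_left _ _) (List.subset_append_left _ _)

theorem Prog.Frame.ite_right {b : Test} {P Q : Prog} {s s' : Store} (h : Q.Frame s s') :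
    (Prog.ite b P Q).Frame s s' :=
  h.weaken (List.subset_append_right _ _) (List.subset_append_right _ _)

theorem Prog.Frame.loop {b : Test} {P : Prog} {s₁ s₂ s₃ : Store} (hP : P.Frame s₁ s₂)
    (h : (Prog.loop b P).Frame s₂ s₃) : (Prog.loop b P).Frame s₁ s₃ :=
  (hP.weaken (Q := .loop b P) (fun _ h => h) fun _ h => h).trans h

/-- The program `P`, started in `s`, draws `x` from `p` and ends within `t` steps in a memory
satisfying `R x`, asking the oracle with tolerance `1 / 2` only.  This is stated as a lower bound
for expectations over all continuations of the computation. -/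
def Draws {α : Type*} (O : Oracle) (P : Prog) (s : Store) (t : ℕ) (p : PMF α)
    (R : α → Store → Prop) : Prop :=
  ∀ (ψ : Store → ℝ≥0∞) (K : List Prog) (m : ℕ) (a : α → ℝ≥0∞),
    (∀ x s', R x s' → P.Frame s s' → a x ≤ expect O ψ m ⟨K, s'⟩) →
      mean p a ≤ expect O ψ (m + t) ⟨P :: K, s⟩

section Draws

variable {O : Oracle} {α β : Type*} {P Q : Prog} {b : Test} {s : Store} {t t₁ t₂ : ℕ} {p : PMF α}
  {q : α → PMF β} {R : α → Store → Prop} {S : β → Store → Prop}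

theorem Draws.mono {u : ℕ} {R' : α → Store → Prop} (h : Draws O P s t p R) (ht : t ≤ u)
    (hR : ∀ x s', R x s' → P.Frame s s' → R' x s') : Draws O P s u p R' := fun ψ K m a ha =>
  (h ψ K m a fun x s' hx hs' => ha x s' (hR x s' hx hs') hs').trans (expect_mono _ (by lia))

theorem Draws.map {f : α → β} (h : Draws O P s t p fun x => S (f x)) :
    Draws O P s t (p.map f) S := fun ψ K m a ha => by
  rw [mean_map]
  exact h ψ K m _ fun x => ha (f x)

theorem Draws.flip (r : ℕ) : Draws O (.flip r) s 1 (PMF.uniformOfFintype Bool) fun x s' =>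
    s' = { s with reg := Function.update s.reg r (if x then 1 else 0) } := fun ψ K m a ha => by
  rw [expect_succ (by simp [BadQuery]), step, mean_map]
  refine mean_mono _ fun x => ha x _ rfl ⟨fun r' hr => ?_, fun _ _ => rfl⟩
  exact Function.update_of_ne (by simpa [Prog.regs] using hr) _ _

theorem Draws.query {k d l : ℕ} (hd : s.reg d = 1 / 2) :
    Draws O (.query k d l) s 1 (O (s.stk k) (1 / 2)) fun w s' =>
      s' = { s with stk := Function.update s.stk l w } := fun ψ K m a ha => by
  rw [expect_succ (by simp [BadQuery, hd]), step, mean_map, hd]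
  refine mean_mono _ fun w => ha w _ rfl ⟨fun _ _ => rfl, fun k' hk => ?_⟩
  exact Function.update_of_ne (by simpa [Prog.stks] using hk) _ _

theorem Draws.seq (hP : Draws O P s t₁ p R)
    (hQ : ∀ x s', R x s' → P.Frame s s' → Draws O Q s' t₂ (q x) S) :
    Draws O (.seq P Q) s (t₁ + t₂ + 1) (p.bind q) S := fun ψ K m a ha => by
  rw [mean_bind, show m + (t₁ + t₂ + 1) = m + t₂ + t₁ + 1 by ring,
    expect_succ_of_step (by simp [BadQuery]) rfl]
  exact hP ψ _ _ _ fun x s' hx hs' => hQ x s' hx hs' ψ K m a fun y s'' hy hs'' =>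
    ha y s'' hy (hs'.seq hs'')

theorem Draws.loop_true (hb : b.Holds s) (hP : Draws O P s t₁ p R)
    (hQ : ∀ x s', R x s' → P.Frame s s' → Draws O (.loop b P) s' t₂ (q x) S) :
    Draws O (.loop b P) s (t₁ + t₂ + 1) (p.bind q) S := fun ψ K m a ha => by
  rw [mean_bind, show m + (t₁ + t₂ + 1) = m + t₂ + t₁ + 1 by ring,
    expect_succ_of_step (c' := ⟨P :: .loop b P :: K, s⟩) (by simp [BadQuery]) (by simp [step, hb])]
  exact hP ψ _ _ _ fun x s' hx hs' => hQ x s' hx hs' ψ K m a fun y s'' hy hs'' =>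
    ha y s'' hy (hs'.loop hs'')

theorem Draws.ite_true (hb : b.Holds s) (h : Draws O P s t p R) :
    Draws O (.ite b P Q) s (t + 1) p R := fun ψ K m a ha => by
  rw [← add_assoc, expect_succ_of_step (c' := ⟨P :: K, s⟩) (by simp [BadQuery])
    (by simp [step, hb])]
  exact h ψ K m a fun x s' hx hs' => ha x s' hx hs'.ite_left

theorem Draws.ite_false (hb : ¬ b.Holds s) (h : Draws O Q s t p R) :
    Draws O (.ite b P Q) s (t + 1) p R := fun ψ K m a ha => by
  rw [← add_assoc, expect_succ_of_step (c' := ⟨Q :: K, s⟩) (by simp [BadQuery])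
    (by simp [step, hb])]
  exact h ψ K m a fun x s' hx hs' => ha x s' hx hs'.ite_right

theorem Draws.toOuterMeasure_le {A : Set α} {B : Set Store} (h : Draws O P s t p R)
    (hAB : ∀ x s', x ∈ A → R x s' → s' ∈ B) :
    p.toOuterMeasure A ≤ (run O t ⟨[P], s⟩).toOuterMeasure {c | c.store ∈ B} := by
  rw [← mean_indicator, ← zero_add t]
  refine (h (B.indicator 1) [] 0 _ fun x s' hx _ => ?_).trans (expect_indicator_le B _ _)
  rw [expect_halted]
  by_cases hA : x ∈ A
  · simp [hA, hAB x s' hA hx]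
  · simp [hA]

theorem Draws.one_le_expect (h : Draws O P s t p R) :
    1 ≤ expect O (fun _ => 1) t ⟨[P], s⟩ := by
  simpa only [mean_const, zero_add] using
    h (fun _ => 1) [] 0 (fun _ => 1) fun _ _ _ _ => (expect_halted _ _).ge

theorem Draws.haltsWithin (h : Draws O P s t p R) : HaltsWithin O P s t fun _ => True :=
  fun c hc => ⟨(halted_of_one_le_expect (fun _ => le_rfl) h.one_le_expect c hc).1, trivial⟩

theorem Draws.tolerance_eq_half (h : Draws O P s t p R) {u : ℕ} {c : Cfg}
    (hc : c ∈ (run O u ⟨[P], s⟩).support) {k d a : ℕ} {K : List Prog}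
    (hK : c.todo = Prog.query k d a :: K) : c.store.reg d = 1 / 2 := by
  by_contra hd
  exact not_badQuery_of_one_le_expect (fun _ => le_rfl) h.one_le_expect u c hc ⟨k, d, a, K, hK, hd⟩

end Draws

/-- The program `P`, started in `s`, ends within `t` steps in a memory satisfying `A`, without
any choice at random. -/
abbrev Reaches (O : Oracle) (P : Prog) (s : Store) (t : ℕ) (A : Store → Prop) : Prop :=
  Draws O P s t (PMF.pure ()) fun _ => A

section Reaches

variable {O : Oracle} {α : Type*} {P Q : Prog} {b : Test} {s : Store} {t t₁ t₂ : ℕ}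
  {A : Store → Prop} {p : PMF α} {R : α → Store → Prop}

theorem Reaches.mono {u : ℕ} {B : Store → Prop} (h : Reaches O P s t A) (ht : t ≤ u)
    (hAB : ∀ s', A s' → P.Frame s s' → B s') : Reaches O P s u B :=
  Draws.mono h ht fun _ => hAB

theorem Reaches.skip : Reaches O .skip s 1 fun s' => s' = s := fun ψ K m a ha => by
  rw [mean_pure, expect_succ_of_step (by simp [BadQuery]) rfl]
  exact ha () s rfl (.refl _ s)

theorem Reaches.instr (i : Instr) : Reaches O (.instr i) s 1 fun s' => s' = i.exec s :=
  fun ψ K m a ha => by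
    rw [mean_pure, expect_succ_of_step (by simp [BadQuery]) rfl]
    exact ha () _ rfl (.instr i s)

theorem Reaches.loop_false (hb : ¬ b.Holds s) : Reaches O (.loop b P) s 1 fun s' => s' = s :=
  fun ψ K m a ha => by
    rw [mean_pure, expect_succ_of_step (c' := ⟨K, s⟩) (by simp [BadQuery]) (by simp [step, hb])]
    exact ha () s rfl (.refl _ s)

theorem Reaches.seq (hP : Reaches O P s t₁ A)
    (hQ : ∀ s', A s' → P.Frame s s' → Draws O Q s' t₂ p R) :
    Draws O (.seq P Q) s (t₁ + t₂ + 1) p R := by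
  simpa only [PMF.pure_bind] using Draws.seq (q := fun _ => p) hP fun _ => hQ

theorem Reaches.loop_true (hb : b.Holds s) (hP : Reaches O P s t₁ A)
    (hQ : ∀ s', A s' → P.Frame s s' → Draws O (.loop b P) s' t₂ p R) :
    Draws O (.loop b P) s (t₁ + t₂ + 1) p R := by
  simpa only [PMF.pure_bind] using Draws.loop_true (q := fun _ => p) hb hP fun _ => hQ

theorem Reaches.draws {S : α → Store → Prop} {x : α} (h : Reaches O P s t (S x)) :
    Draws O P s t (PMF.pure x) S := by
  rw [← PMF.pure_map (fun _ => x) ()]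
  exact Draws.map h

theorem Draws.seq_reaches {S : α → Store → Prop} (hP : Draws O P s t₁ p R)
    (hQ : ∀ x s', R x s' → P.Frame s s' → Reaches O Q s' t₂ (S x)) :
    Draws O (.seq P Q) s (t₁ + t₂ + 1) p S := by
  rw [← PMF.bind_pure p]
  exact hP.seq fun x s' hx hs' => (hQ x s' hx hs').draws

theorem Reaches.haltsWithin (h : Reaches O P s t A) : HaltsWithin O P s t A := by
  intro c hc
  have h_one := h (Set.indicator {s' | A s'} 1) [] 0 1 fun _ s' hs' _ => by
    simp [expect_halted, show s' ∈ {s' | A s'} from hs']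
  rw [mean_pure, zero_add] at h_one
  obtain ⟨h_halted, h_store⟩ := halted_of_one_le_expect
    (Set.indicator_le_self' fun _ _ => zero_le_one) h_one c hc
  refine ⟨h_halted, ?_⟩
  by_contra hn
  simp [hn] at h_store

theorem Reaches.loop_stack {k : ℕ} (I : List ℝ → Store → Prop) (hI : I (s.stk k) s)
    (hP : ∀ x l s', (Prog.loop (.neg (.empty k)) P).Frame s s' → s'.stk k = x :: l →
      I (x :: l) s' → Reaches O P s' t fun s'' => s''.stk k = l ∧ I l s'') :
    Reaches O (.loop (.neg (.empty k)) P) s ((t + 1) * (s.stk k).length + 1) fun s' =>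
      s'.stk k = [] ∧ I [] s' := by
  suffices ∀ l s', (Prog.loop (.neg (.empty k)) P).Frame s s' → s'.stk k = l → I l s' →
      Reaches O (.loop (.neg (.empty k)) P) s' ((t + 1) * l.length + 1) fun s'' =>
        s''.stk k = [] ∧ I [] s'' from this _ s (.refl _ s) rfl hI
  intro l
  induction l with
  | nil =>
    intro s' _ hl hI
    refine (Reaches.loop_false (by simp [Test.Holds, hl])).mono (by simp) ?_
    rintro _ rfl -
    exact ⟨hl, hI⟩
  | cons x l ih =>
    intro s' hs' hl hI
    refine (Reaches.loop_true (by simp [Test.Holds, hl]) (hP x l s' hs' hl hI)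
      fun s'' h hs'' => ih s'' (hs'.trans ?_) h.1 h.2).mono ?_ fun _ _ h _ => h
    · exact hs''.loop (.refl _ s'')
    · simp only [List.length_cons]
      lia

end Reaches

/-- Programs without loops, coin flips and oracle calls. -/
def Prog.straight : Prog → Bool
  | .skip | .instr _ => true
  | .flip _ | .query _ _ _ | .loop _ _ => false
  | .seq P Q | .ite _ P Q => P.straight && Q.straight

open Classical in
/-- The effect of a program without loops, coin flips and oracle calls. -/
def Prog.effect : Prog → Store → Store
  | .instr i, s => i.exec s
  | .seq P Q, s => Q.effect (P.effect s)
  | .ite t P Q, s => if t.Holds s then P.effect s else Q.effect s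
  | .skip, s | .flip _, s | .query _ _ _, s | .loop _ _, s => s

/-- The number of nodes of a program. -/
def Prog.nodes : Prog → ℕ
  | .skip | .instr _ | .flip _ | .query _ _ _ => 1
  | .seq P Q | .ite _ P Q => P.nodes + Q.nodes + 1
  | .loop _ P => P.nodes + 1

theorem Reaches.of_straight {O : Oracle} {P : Prog} (s : Store)
    (hP : P.straight = true := by rfl) :
    Reaches O P s P.nodes fun s' => s' = P.effect s := by
  induction P generalizing s with
  | skip => exact Reaches.skip
  | instr i => exact Reaches.instr i
  | flip r | query k d a | loop t P => simp [Prog.straight] at hP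
  | seq P Q ihP ihQ =>
    simp only [Prog.straight, Bool.and_eq_true] at hP
    exact (ihP s hP.1).seq fun s' h _ => h ▸ ihQ s' hP.2
  | ite t P Q ihP ihQ =>
    simp only [Prog.straight, Bool.and_eq_true] at hP
    by_cases h : t.Holds s
    · simpa [Prog.effect, h] using
        (Draws.ite_true h (ihP s hP.1)).mono (by simp [Prog.nodes]) fun _ _ h _ => h
    · simpa [Prog.effect, h] using
        (Draws.ite_false h (ihQ s hP.2)).mono (by simp [Prog.nodes]) fun _ _ h _ => h

/-- The program that executes a list of instructions. -/
def instrs : List Instr → Prog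
  | [] => .skip
  | [i] => .instr i
  | i :: l => .seq (.instr i) (instrs l)

namespace Reg

-- Register `0` is that of the output, and registers `1` to `7` hold the state of the evaluation
-- machine.
abbrev output : ℕ := 0
abbrev pending : ℕ := 1
abbrev left : ℕ := 2
abbrev index : ℕ := 3
abbrev value : ℕ := 4
abbrev sign : ℕ := 5
abbrev level : ℕ := 6
abbrev alive : ℕ := 7
abbrev threshold : ℕ := 8
abbrev entry : ℕ := 9
abbrev position : ℕ := 10
abbrev picked : ℕ := 11
abbrev countdown : ℕ := 12
abbrev scratch : ℕ := 13
abbrev zero : ℕ := 14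
abbrev one : ℕ := 15
abbrev numVars : ℕ := 16
abbrev varCount : ℕ := 17
abbrev checkCount : ℕ := 18
abbrev rounds : ℕ := 19
abbrev half : ℕ := 20
abbrev marker : ℕ := 21

end Reg

namespace Stk

abbrev word : ℕ := 0
abbrev current : ℕ := 1
abbrev assignment : ℕ := 2
abbrev spare : ℕ := 3
abbrev done : ℕ := 4
abbrev discard : ℕ := 5
abbrev answer : ℕ := 6

end Stk

/-- The registers reserved for the constants `0` and `1` hold them. -/
structure Store.HasConstants (s : Store) : Prop where
  zero : s.reg Reg.zero = 0
  one : s.reg Reg.one = 1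

theorem Store.HasConstants.of_frame {s s' : Store} {P : Prog} (hs : s.HasConstants)
    (h : P.Frame s s') (h0 : Reg.zero ∉ P.regs := by decide)
    (h1 : Reg.one ∉ P.regs := by decide) : s'.HasConstants :=
  ⟨(h.reg _ h0).trans hs.zero, (h.reg _ h1).trans hs.one⟩

/-- Move the contents of stack `a` onto stack `b`, in reverse order. -/
def moveAll (a b : ℕ) : Prog :=
  .loop (.neg (.empty a)) (instrs [.pop Reg.scratch a, .push b Reg.scratch])

theorem moveAll_reaches {O : Oracle} {a b : ℕ} (hab : a ≠ b) (s : Store) :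
    Reaches O (moveAll a b) s (4 * (s.stk a).length + 1) fun s' =>
      s'.stk a = [] ∧ s'.stk b = (s.stk a).reverse ++ s.stk b := by
  refine (Reaches.loop_stack
    (fun l s' => l.reverse ++ s'.stk b = (s.stk a).reverse ++ s.stk b) rfl
    fun x l s' _ hl hI => (Reaches.of_straight s').mono le_rfl ?_).mono le_rfl
      fun s' h _ => ⟨h.1, by simpa using h.2⟩
  rintro _ rfl -
  simpa [instrs, Prog.effect, Instr.exec, hab, hab.symm, hl] using hI

/-! ## The evaluation machine -/

/-- The entry of a list at position `u`, with default value `b`. -/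
def pick : List ℝ → ℝ → ℝ → ℝ
  | [], _, b => b
  | x :: B, u, b => pick B (u - 1) (if u = 0 then x else b)

/-- The state of the evaluation machine, which reads a word from left to right against an
assignment: the numbers of argument indices and of table entries still to be read, the distance to
the entry to be selected, the product of the selected entries, the sign of the current parity check,
`2` to the number of checks passed before the first failure, and whether no check has failed.  All
components are reals because they are kept in registers. -/
@[ext]
structure EvalState where
  pending : ℝ
  left : ℝ
  index : ℝ
  value : ℝ
  sign : ℝ
  level : ℝ
  alive : ℝ

def EvalState.init : EvalState := ⟨0, 0, 0, 1, 1, 1, 1⟩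

/-- The position of the assignment that the entry `v` of a word refers to: `-(i + 1)` stands for
variable `i` in a parity check. -/
def position (v : ℝ) : ℝ := if 0 ≤ v then v else -1 - v

open Classical in
/-- The effect of reading the entry `v` if it refers to a variable of value `b`.  Nonnegative
entries form applications of constraints.  A negative entry adds a variable to the current parity
check, except that `-1 / 2`, which has no position, closes the check. -/
def EvalState.read (b v : ℝ) (σ : EvalState) : EvalState :=
  if 0 ≤ v then
    if σ.left ≤ 0 then { σ with pending := v, index := 0, left := 1 }
    else if 1 ≤ σ.pending then
      { σ with index := σ.index + σ.index + b, left := σ.left + σ.left, pending := σ.pending - 1 }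
    else
      { σ with
        value := if σ.index = 0 then σ.value * v else σ.value
        index := σ.index - 1
        left := σ.left - 1 }
  else if 0 ≤ position v then { σ with sign := σ.sign * (1 - (b + b)) }
  else if 1 ≤ σ.alive ∧ 1 ≤ σ.sign then { σ with level := σ.level + σ.level, sign := 1 }
  else { σ with alive := 0, sign := 1 }

/-- The state after reading a word against the assignment `B`. -/
def evalWord (B : List ℝ) (w : List ℝ) (σ : EvalState) : EvalState :=
  w.foldl (fun σ v => σ.read (pick B (position v) 0) v) σ

/-- The state of the evaluation machine as it is kept in the registers. -/
def EvalState.of (s : Store) : EvalState :=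
  ⟨s.reg Reg.pending, s.reg Reg.left, s.reg Reg.index, s.reg Reg.value, s.reg Reg.sign,
    s.reg Reg.level, s.reg Reg.alive⟩

theorem Prog.Frame.evalState {P : Prog} {s s' : Store} (h : P.Frame s s')
    (hP : ∀ r ∈ P.regs, r = 0 ∨ 8 ≤ r := by decide) : EvalState.of s' = EvalState.of s := by
  have h_reg (r : ℕ) (h0 : 1 ≤ r) (h7 : r ≤ 7) : s'.reg r = s.reg r :=
    h.reg r fun hr => by have := hP r hr; lia
  ext <;> exact h_reg _ (by decide) (by decide)

section

variable {O : Oracle} {s : Store}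

def pickBody : Prog :=
  .seq (instrs [.pop Reg.scratch Stk.assignment, .push Stk.spare Reg.scratch]) <|
  .seq
    (.ite (.le Reg.countdown Reg.zero)
      (.ite (.le Reg.zero Reg.countdown) (.instr (.copy Reg.picked Reg.scratch)) .skip) .skip)
    (.instr (.sub Reg.countdown Reg.countdown Reg.one))

/-- Look up the assignment at the position in register `Reg.countdown`. -/
def pickProg : Prog :=
  .seq (.loop (.neg (.empty Stk.assignment)) pickBody) (moveAll Stk.spare Stk.assignment)

theorem pickBody_effect (hs : s.HasConstants) {x : ℝ} {l : List ℝ}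
    (hl : s.stk Stk.assignment = x :: l) :
    (pickBody.effect s).stk Stk.assignment = l ∧
    (pickBody.effect s).stk Stk.spare = x :: s.stk Stk.spare ∧
    (pickBody.effect s).reg Reg.countdown = s.reg Reg.countdown - 1 ∧
    (pickBody.effect s).reg Reg.picked =
      if s.reg Reg.countdown = 0 then x else s.reg Reg.picked := by
  have h_eq : s.reg Reg.countdown = 0 ↔ s.reg Reg.countdown ≤ 0 ∧ 0 ≤ s.reg Reg.countdown :=
    le_antisymm_iff
  by_cases h : s.reg Reg.countdown ≤ 0 <;> by_cases h' : 0 ≤ s.reg Reg.countdown <;>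
    simp [pickBody, instrs, Prog.effect, Instr.exec, Test.Holds, hl, hs.zero, hs.one, h, h', h_eq]

theorem pickProg_reaches (hs : s.HasConstants) (h_spare : s.stk Stk.spare = []) :
    Reaches O pickProg s (18 * (s.stk Stk.assignment).length + 3) fun s' =>
      s'.stk Stk.assignment = s.stk Stk.assignment ∧ s'.stk Stk.spare = [] ∧
      s'.reg Reg.picked =
        pick (s.stk Stk.assignment) (s.reg Reg.countdown) (s.reg Reg.picked) := by
  have h_loop := Reaches.loop_stack (O := O) (s := s) (k := Stk.assignment) (P := pickBody)
    (t := pickBody.nodes) (fun l s' =>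
      l.reverse ++ s'.stk Stk.spare = (s.stk Stk.assignment).reverse ∧
      pick l (s'.reg Reg.countdown) (s'.reg Reg.picked) =
        pick (s.stk Stk.assignment) (s.reg Reg.countdown) (s.reg Reg.picked))
    ⟨by simp [h_spare], rfl⟩ fun x l s₁ hF hl hI => by
      refine (Reaches.of_straight s₁).mono le_rfl ?_
      rintro _ rfl -
      obtain ⟨h_assignment, h_spare, h_countdown, h_picked⟩ :=
        pickBody_effect (hs.of_frame hF) hl
      refine ⟨h_assignment, ?_, ?_⟩
      · rw [h_spare, ← hI.1]
        simp
      · rw [h_countdown, h_picked, ← hI.2, pick]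
  refine (h_loop.seq (t₂ := 4 * (s.stk Stk.assignment).length + 1) fun s₁ h₁ _ =>
    (moveAll_reaches (by decide) s₁).mono ?_ fun s₂ h₂ hF => ?_).mono ?_ fun _ _ h _ => h
  · simp [show s₁.stk Stk.spare = _ from h₁.2.1]
  · exact ⟨by simp [h₂.2, h₁.1, show s₁.stk Stk.spare = _ from h₁.2.1], h₂.1,
      (hF.reg Reg.picked).trans h₁.2.2⟩
  · have : pickBody.nodes = 11 := rfl
    lia

def fetchProg : Prog :=
  .seq (instrs [.pop Reg.entry Stk.word, .push Stk.done Reg.entry]) <|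
  .seq
    (.ite (.le Reg.zero Reg.entry) (.instr (.copy Reg.position Reg.entry))
      (instrs [.const Reg.position (-1), .sub Reg.position Reg.position Reg.entry]))
    (instrs [.copy Reg.countdown Reg.position, .const Reg.picked 0])

def readProg : Prog :=
  .ite (.le Reg.zero Reg.entry)
    (.ite (.le Reg.left Reg.zero)
      (instrs [.copy Reg.pending Reg.entry, .const Reg.index 0, .const Reg.left 1])
      (.ite (.le Reg.one Reg.pending)
        (instrs [.add Reg.index Reg.index Reg.index, .add Reg.index Reg.index Reg.picked,
          .add Reg.left Reg.left Reg.left, .sub Reg.pending Reg.pending Reg.one])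
        (.seq
          (.ite (.le Reg.index Reg.zero)
            (.ite (.le Reg.zero Reg.index) (.instr (.mul Reg.value Reg.value Reg.entry)) .skip)
            .skip)
          (instrs [.sub Reg.index Reg.index Reg.one, .sub Reg.left Reg.left Reg.one]))))
    (.ite (.le Reg.zero Reg.position)
      (instrs [.add Reg.scratch Reg.picked Reg.picked, .sub Reg.scratch Reg.one Reg.scratch,
        .mul Reg.sign Reg.sign Reg.scratch])
      (.seq
        (.ite (.le Reg.one Reg.alive)
          (.ite (.le Reg.one Reg.sign) (.instr (.add Reg.level Reg.level Reg.level))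
            (.instr (.const Reg.alive 0)))
          (.instr (.const Reg.alive 0)))
        (.instr (.const Reg.sign 1))))

def evalBody : Prog := .seq fetchProg <| .seq pickProg readProg

/-- Read the word on stack `Stk.word` against the assignment on stack `Stk.assignment`. -/
def evalLoop : Prog := .loop (.neg (.empty Stk.word)) evalBody

theorem fetchProg_effect (hs : s.HasConstants) {v : ℝ} {l : List ℝ}
    (hl : s.stk Stk.word = v :: l) :
    (fetchProg.effect s).stk Stk.word = l ∧
    (fetchProg.effect s).stk Stk.done = v :: s.stk Stk.done ∧
    (fetchProg.effect s).reg Reg.entry = v ∧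
    (fetchProg.effect s).reg Reg.position = position v ∧
    (fetchProg.effect s).reg Reg.countdown = position v ∧
    (fetchProg.effect s).reg Reg.picked = 0 := by
  by_cases hv : 0 ≤ v <;>
    simp [fetchProg, instrs, Prog.effect, Instr.exec, Test.Holds, hl, hs.zero, hv, position]

theorem readProg_effect (hs : s.HasConstants)
    (h_position : s.reg Reg.position = position (s.reg Reg.entry)) :
    EvalState.of (readProg.effect s) =
      (EvalState.of s).read (s.reg Reg.picked) (s.reg Reg.entry) := by
  have h_eq : s.reg Reg.index = 0 ↔ s.reg Reg.index ≤ 0 ∧ 0 ≤ s.reg Reg.index := le_antisymm_iff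
  simp only [readProg, instrs, Prog.effect, Instr.exec, Test.Holds, EvalState.of, EvalState.read,
    hs.zero, hs.one, h_position, h_eq, ite_and]
  split_ifs <;> simp_all [hs.one]
  grind

theorem evalBody_reaches (hs : s.HasConstants) (h_spare : s.stk Stk.spare = []) {v : ℝ}
    {l : List ℝ} (hl : s.stk Stk.word = v :: l) :
    Reaches O evalBody s (18 * (s.stk Stk.assignment).length + 80) fun s' =>
      EvalState.of s' =
        (EvalState.of s).read (pick (s.stk Stk.assignment) (position v) 0) v ∧
      s'.stk Stk.word = l ∧ s'.stk Stk.done = v :: s.stk Stk.done ∧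
      s'.stk Stk.assignment = s.stk Stk.assignment ∧ s'.stk Stk.spare = [] := by
  obtain ⟨h_word, h_done, h_entry, h_position, h_countdown, h_picked⟩ := fetchProg_effect hs hl
  refine ((Reaches.of_straight (P := fetchProg) s).seq
    (t₂ := 18 * (s.stk Stk.assignment).length + 59) ?_).mono ?_ fun _ _ h _ => h
  · rintro _ rfl hF₁
    rw [← hF₁.stk Stk.assignment]
    refine ((pickProg_reaches (hs.of_frame hF₁) ((hF₁.stk Stk.spare).trans h_spare)).seq
      (t₂ := readProg.nodes) fun s₂ h₂ hF₂ =>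
        (Reaches.of_straight s₂).mono le_rfl ?_).mono ?_ fun _ _ h _ => h
    · rintro _ rfl hF₃
      have hs₂ := (hs.of_frame hF₁).of_frame hF₂
      rw [hF₃.stk Stk.word, hF₃.stk Stk.done, hF₃.stk Stk.assignment, hF₃.stk Stk.spare,
        hF₂.stk Stk.word, hF₂.stk Stk.done, h_word, h_done]
      refine ⟨?_, rfl, rfl, h₂.1, h₂.2.1⟩
      rw [readProg_effect hs₂ (by
        rw [hF₂.reg Reg.position, hF₂.reg Reg.entry, h_position, h_entry]), hF₂.evalState,
        hF₁.evalState, hF₂.reg Reg.entry, h_entry, h₂.2.2, h_countdown, h_picked]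
    · have : readProg.nodes ≤ 55 := by decide
      lia
  · have : fetchProg.nodes ≤ 20 := by decide
    lia

theorem evalLoop_reaches (hs : s.HasConstants) (h_spare : s.stk Stk.spare = []) :
    Reaches O evalLoop s
      ((18 * (s.stk Stk.assignment).length + 81) * (s.stk Stk.word).length + 1) fun s' =>
      EvalState.of s' = evalWord (s.stk Stk.assignment) (s.stk Stk.word) (EvalState.of s) ∧
      s'.stk Stk.word = [] ∧ s'.stk Stk.done = (s.stk Stk.word).reverse ++ s.stk Stk.done ∧
      s'.stk Stk.assignment = s.stk Stk.assignment ∧ s'.stk Stk.spare = [] := by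
  refine (Reaches.loop_stack (fun l s' =>
    evalWord (s.stk Stk.assignment) l (EvalState.of s') =
      evalWord (s.stk Stk.assignment) (s.stk Stk.word) (EvalState.of s) ∧
    l.reverse ++ s'.stk Stk.done = (s.stk Stk.word).reverse ++ s.stk Stk.done ∧
    s'.stk Stk.assignment = s.stk Stk.assignment ∧ s'.stk Stk.spare = [])
    ⟨rfl, rfl, rfl, h_spare⟩ (t := 18 * (s.stk Stk.assignment).length + 80) ?_).mono le_rfl
      fun s' ⟨h_word, h_eval, h_done, h⟩ _ => ⟨h_eval, h_word, h_done, h⟩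
  rintro v l s₁ hF hl ⟨h_eval, h_done, h_assignment, h_spare⟩
  rw [← h_assignment]
  refine (evalBody_reaches (hs.of_frame hF) h_spare hl).mono le_rfl ?_
  rintro s₂ ⟨g_eval, g_word, g_done, g_assignment, g_spare⟩ -
  refine ⟨g_word, ?_, ?_, g_assignment, g_spare⟩
  · rw [g_eval, h_assignment, ← h_eval]
    rfl
  · simp [g_done, ← h_done]

def initProg : Prog :=
  instrs [.const Reg.pending 0, .const Reg.left 0, .const Reg.index 0, .const Reg.value 1,
    .const Reg.sign 1, .const Reg.level 1, .const Reg.alive 1]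

/-- Evaluate the word on stack `Stk.word` against the assignment on stack `Stk.assignment`. -/
def evalProg : Prog := .seq initProg evalLoop

theorem evalProg_reaches (hs : s.HasConstants) (h_spare : s.stk Stk.spare = []) :
    Reaches O evalProg s
      ((18 * (s.stk Stk.assignment).length + 81) * (s.stk Stk.word).length + 15) fun s' =>
      EvalState.of s' = evalWord (s.stk Stk.assignment) (s.stk Stk.word) .init ∧
      s'.stk Stk.word = [] ∧ s'.stk Stk.done = (s.stk Stk.word).reverse ++ s.stk Stk.done ∧
      s'.stk Stk.assignment = s.stk Stk.assignment ∧ s'.stk Stk.spare = [] := by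
  refine ((Reaches.of_straight (P := initProg) s).seq ?_).mono
    (t := initProg.nodes + ((18 * (s.stk Stk.assignment).length + 81) *
      (s.stk Stk.word).length + 1) + 1) ?_ fun _ _ h _ => h
  · rintro _ rfl hF
    have h_init : EvalState.of (initProg.effect s) = .init := by
      simp [initProg, instrs, Prog.effect, Instr.exec, EvalState.of, EvalState.init]
    simpa only [h_init, hF.stk Stk.assignment, hF.stk Stk.word, hF.stk Stk.done] using
      evalLoop_reaches (O := O) (hs.of_frame hF) ((hF.stk Stk.spare).trans h_spare)
  · have : initProg.nodes = 13 := rfl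
    lia

end

/-! ## The target problem -/

open Classical in
/-- The measure of the assignment `B` for the word `w`, which consists of a threshold and a word for
the evaluation machine.  Assignments with a value above the threshold are rated by the number of
parity checks that they pass before their first failure; all other ones have measure `1`. -/
def score (w B : List ℝ) : ℝ :=
  if (evalWord B w.tail .init).value ≤ w.headD 0 then 1 else 2 * (evalWord B w.tail .init).level

theorem EvalState.read_level (b v : ℝ) (σ : EvalState) :
    (σ.read b v).level = σ.level ∨ (σ.read b v).level = 2 * σ.level := by
  unfold EvalState.read
  split_ifs <;> simp [two_mul]

theorem evalWord_level_bounds (B w : List ℝ) (σ : EvalState) (h : 1 ≤ σ.level) :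
    1 ≤ (evalWord B w σ).level ∧ (evalWord B w σ).level ≤ 2 ^ w.length * σ.level := by
  induction w generalizing σ with
  | nil => simpa [evalWord] using h
  | cons v w ih =>
    have h_read := σ.read_level (pick B (position v) 0) v
    obtain ⟨h_lower, h_upper⟩ := ih (σ.read (pick B (position v) 0) v) (by
      rcases h_read with h_read | h_read <;> rw [h_read] <;> linarith)
    refine ⟨h_lower, h_upper.trans ?_⟩
    rw [List.length_cons, pow_succ, mul_assoc]
    gcongr
    rcases h_read with h_read | h_read <;> rw [h_read]
    linarith

theorem score_bounds (w B : List ℝ) : 1 ≤ score w B ∧ score w B ≤ 2 ^ (w.length + 1) := by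
  obtain ⟨h_lower, h_upper⟩ := evalWord_level_bounds B w.tail .init le_rfl
  have h_pow : (2 : ℝ) ^ w.tail.length ≤ 2 ^ w.length :=
    pow_le_pow_right₀ one_le_two (by simp)
  rw [show EvalState.init.level = 1 from rfl, mul_one] at h_upper
  unfold score
  split_ifs
  · exact ⟨le_rfl, one_le_pow₀ one_le_two⟩
  · rw [pow_succ]
    constructor <;> linarith

theorem score_pos (w B : List ℝ) : 0 < score w B := zero_lt_one.trans_le (score_bounds w B).1

/-- The problem of improving an assignment, subject to parity checks.  Every word of reals is an
instance, and short assignments stand for their extensions by `0`. -/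
def improvement : OptProblem where
  Inst := List ℝ
  encode := id
  encode_injective := Function.injective_id
  sol := fun w => {y | y.length ≤ w.length}
  measure := fun w y => (score w (bits y)).toNNReal
  goal := .maximize

theorem coe_measure_improvement (w : List ℝ) (y : List Bool) :
    (improvement.measure w y : ℝ) = score w (bits y) :=
  Real.coe_toNNReal _ (score_pos w _).le

theorem measure_improvement_ne_zero (w : List ℝ) (y : List Bool) :
    improvement.measure w y ≠ 0 :=
  (Real.toNNReal_pos.2 (score_pos w _)).ne'

theorem improvement_exists_isOptimal (w : List ℝ) : ∃ z, improvement.IsOptimal w z := by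
  have h_finite : (improvement.sol w).Finite := List.finite_length_le Bool w.length
  obtain ⟨z, hz, h_max⟩ := h_finite.exists_maximalFor (improvement.measure w) _
    ⟨[], show [].length ≤ w.length by simp⟩
  exact ⟨z, hz, fun y hy => (le_total _ _).elim id fun h => h_max hy h⟩

theorem improvement_isApprox {w : List ℝ} {r : ℝ} {y : List Bool} (hy : y.length ≤ w.length)
    (hr : 2 ^ (w.length + 1) ≤ r) : improvement.IsApprox r w y := by
  obtain ⟨z, hz⟩ := improvement_exists_isOptimal w
  refine ⟨hy, z, hz, fun h => absurd h (measure_improvement_ne_zero w z), fun _ => ?_⟩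
  obtain ⟨hy_lower, hy_upper⟩ := score_bounds w (bits y)
  obtain ⟨hz_lower, hz_upper⟩ := score_bounds w (bits z)
  have hr_pos : 0 < r := lt_of_lt_of_le (by positivity) hr
  rw [coe_measure_improvement, coe_measure_improvement,
    abs_of_pos (div_pos (score_pos w _) (score_pos w _)),
    div_le_div_iff₀ hr_pos (score_pos w _), div_le_iff₀ (score_pos w _)]
  constructor <;> nlinarith

theorem score_le_of_isApprox {w : List ℝ} {r : ℝ} {y z : List Bool}
    (hy : improvement.IsApprox r w y) (hz : z.length ≤ w.length) :
    score w (bits z) ≤ score w (bits y) * r := by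
  obtain ⟨-, x, ⟨-, h_opt⟩, -, h_ratio⟩ := hy
  obtain ⟨h_lower, h_upper⟩ := h_ratio (measure_improvement_ne_zero w x)
  have h_zx : score w (bits z) ≤ score w (bits x) := by
    simpa only [coe_measure_improvement] using NNReal.coe_le_coe.2 (h_opt z hz)
  have h_pos : 0 < score w (bits y) / score w (bits x) := div_pos (score_pos w _) (score_pos w _)
  rw [coe_measure_improvement, coe_measure_improvement, abs_of_pos h_pos] at h_lower h_upper
  rw [div_le_div_iff₀ (h_pos.trans_le h_upper) (score_pos w _), one_mul] at h_lower
  exact h_zx.trans h_lower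

section

variable {O : Oracle}

def compareBody : Prog :=
  .seq (.ite (.empty Stk.word) (.instr (.const Reg.picked 1)) .skip)
    (instrs [.pop Reg.scratch Stk.word, .pop Reg.scratch Stk.current])

/-- Test whether the word on stack `Stk.current` is at most as long as the one on stack
`Stk.word`. -/
def compareProg : Prog :=
  .seq (.loop (.neg (.empty Stk.current)) compareBody)
    (instrs [.const Reg.one 1, .sub Reg.output Reg.one Reg.picked])

theorem compareProg_reaches (w y : List ℝ) :
    Reaches O compareProg (load w y 0) (10 * y.length + 5) fun s =>
      s.reg Reg.output = 1 ↔ y.length ≤ w.length := by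
  refine ((Reaches.loop_stack (k := Stk.current) (P := compareBody) (t := compareBody.nodes)
    (fun l s => (if l.length ≤ (s.stk Stk.word).length then s.reg Reg.picked else 1) =
      if y.length ≤ w.length then 0 else 1) (by simp [load]) fun x l s _ hl hI =>
    (Reaches.of_straight s).mono le_rfl ?_).seq
      (t₂ := 3) fun s hs _ => (Reaches.of_straight s).mono le_rfl ?_).mono ?_ fun _ _ h _ => h
  · rintro _ rfl -
    rw [← hI]
    cases h_word : s.stk Stk.word <;>
      simp [compareBody, instrs, Prog.effect, Instr.exec, Test.Holds, hl, h_word]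
  · rintro _ rfl -
    have h_picked : s.reg Reg.picked = if y.length ≤ w.length then 0 else 1 := by
      simpa using hs.2
    by_cases hy : y.length ≤ w.length <;>
      simp [instrs, Prog.effect, Instr.exec, h_picked, hy]
  · have : compareBody.nodes = 7 := rfl
    simp only [load, Stk.current, one_ne_zero, if_false, if_true]
    lia

def setupProg : Prog := instrs [.const Reg.zero 0, .const Reg.one 1, .pop Reg.threshold Stk.word]

def resultProg : Prog :=
  .ite (.le Reg.value Reg.threshold) (.instr (.copy Reg.output Reg.one))
    (.instr (.add Reg.output Reg.level Reg.level))

/-- Compute the measure of the assignment on stack `Stk.current` for the instance on stack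
`Stk.word`. -/
def scoreProg : Prog :=
  .seq setupProg <|
  .seq (moveAll Stk.current Stk.spare) <|
  .seq (moveAll Stk.spare Stk.assignment) <|
  .seq evalProg resultProg

theorem setupProg_effect (w y : List ℝ) (e : ℝ) :
    (setupProg.effect (load w y e)).HasConstants ∧
    (setupProg.effect (load w y e)).reg Reg.threshold = w.headD 0 ∧
    (setupProg.effect (load w y e)).stk Stk.word = w.tail := by
  refine ⟨⟨?_, ?_⟩, ?_, ?_⟩ <;> simp [setupProg, instrs, Prog.effect, Instr.exec, load]

theorem resultProg_effect {s : Store} (hs : s.HasConstants) {w B : List ℝ}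
    (h_eval : EvalState.of s = evalWord B w.tail .init)
    (h_threshold : s.reg Reg.threshold = w.headD 0) :
    (resultProg.effect s).reg Reg.output = score w B := by
  have h_value : s.reg Reg.value = (evalWord B w.tail .init).value :=
    congrArg EvalState.value h_eval
  have h_level : s.reg Reg.level = (evalWord B w.tail .init).level :=
    congrArg EvalState.level h_eval
  rw [score, ← h_value, ← h_level, ← h_threshold]
  by_cases h : s.reg Reg.value ≤ s.reg Reg.threshold <;>
    simp [resultProg, Prog.effect, Instr.exec, Test.Holds, h, hs.one, two_mul]

theorem scoreProg_reaches (w y : List ℝ) :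
    Reaches O scoreProg (load w y 0) ((18 * y.length + 81) * w.length + 8 * y.length + 50) fun s =>
      s.reg Reg.output = score w y := by
  obtain ⟨hs, h_threshold, h_word⟩ := setupProg_effect w y 0
  refine ((Reaches.of_straight (load w y 0)).seq (t₂ :=
    4 * y.length + 1 + (4 * y.length + 1 + ((18 * y.length + 81) * w.length + 15 +
      resultProg.nodes + 1) + 1) + 1) ?_).mono ?_ fun _ _ h _ => h
  · rintro _ rfl hF
    have h_current : (setupProg.effect (load w y 0)).stk Stk.current = y := hF.stk Stk.current
    have h_spare : (setupProg.effect (load w y 0)).stk Stk.spare = [] := hF.stk Stk.spare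
    have h_assignment : (setupProg.effect (load w y 0)).stk Stk.assignment = [] :=
      hF.stk Stk.assignment
    refine Reaches.seq ((moveAll_reaches (by decide) _).mono (by rw [h_current]) fun _ h _ => h)
      fun s₁ h₁ hF₁ => ?_
    rw [h_current, h_spare, List.append_nil] at h₁
    refine Reaches.seq ((moveAll_reaches (by decide) s₁).mono (by simp [h₁.2]) fun _ h _ => h)
      fun s₂ h₂ hF₂ => ?_
    rw [h₁.2, List.reverse_reverse, hF₁.stk Stk.assignment, h_assignment, List.append_nil] at h₂
    have h_word₂ : s₂.stk Stk.word = w.tail := by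
      rw [hF₂.stk Stk.word, hF₁.stk Stk.word, h_word]
    refine Reaches.seq ((evalProg_reaches ((hs.of_frame hF₁).of_frame hF₂) h₂.1).mono ?_
      fun _ h _ => h) fun s₃ h₃ hF₃ => (Reaches.of_straight s₃).mono le_rfl ?_
    · rw [h₂.2, h_word₂, List.length_tail]
      gcongr
      exact Nat.sub_le _ _
    · rintro _ rfl -
      rw [h₂.2, h_word₂] at h₃
      refine resultProg_effect (((hs.of_frame hF₁).of_frame hF₂).of_frame hF₃) h₃.1 ?_
      rw [hF₃.reg Reg.threshold, hF₂.reg Reg.threshold, hF₁.reg Reg.threshold, h_threshold]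
  · have : setupProg.nodes = 5 := rfl
    have : resultProg.nodes = 3 := rfl
    lia

theorem improvement_inNPO : improvement.InNPO where
  inst_rec := ⟨.instr (.const Reg.output 1), trivial, 1, fun w =>
    ((Reaches.instr _).mono (by simp) fun s hs _ => by
      simp [hs, Instr.exec, improvement]).haltsWithin⟩
  sol_rec := by
    refine ⟨compareProg, by simp [compareProg, compareBody, instrs, Prog.Deterministic],
      10 * Polynomial.X + 5, fun w y => ((compareProg_reaches w (bits y)).mono ?_ ?_).haltsWithin⟩
    · simp [bits, OptProblem.size]
    · exact fun s hs _ => hs.trans (by simp [bits, improvement])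
  sol_bound := ⟨Polynomial.X, fun w y hy => by rw [Polynomial.eval_X]; exact hy⟩
  measure_comp := by
    refine ⟨scoreProg, ?_, 18 * Polynomial.X ^ 2 + 89 * Polynomial.X + 50, fun w y _ =>
      ((scoreProg_reaches w (bits y)).mono ?_ ?_).haltsWithin⟩
    · simp [scoreProg, setupProg, resultProg, evalProg, initProg, evalLoop, evalBody, fetchProg,
        pickProg, pickBody, readProg, moveAll, instrs, Prog.Deterministic]
    · have h_size : improvement.size w = w.length := rfl
      simp only [h_size, bits, List.length_map, Polynomial.eval_add, Polynomial.eval_mul,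
        Polynomial.eval_pow, Polynomial.eval_X, Polynomial.eval_ofNat]
      nlinarith [Nat.zero_le (w.length * y.length), Nat.zero_le (w.length ^ 2),
        Nat.zero_le (y.length ^ 2)]
    · exact fun s hs _ => hs.trans (coe_measure_improvement w y).symm

theorem improvement_mem_EXPAPX : improvement ∈ OptProblem.EXPAPX := by
  refine ⟨improvement_inNPO, fun n => 2 ^ (n + 1), ⟨Polynomial.X + 1, fun n => ⟨?_, ?_⟩⟩,
    .skip, trivial, 1, fun w => (Reaches.skip.mono (by simp) fun s hs _ => ?_).haltsWithin⟩
  · exact one_le_pow₀ one_le_two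
  · simp
  · exact ⟨[], by simp [hs, load, bits], improvement_isApprox (Nat.zero_le _) le_rfl⟩

end

/-! ## Evaluating well-formed words -/

theorem evalWord_nil (B : List ℝ) (σ : EvalState) : evalWord B [] σ = σ := rfl

theorem evalWord_cons (B : List ℝ) (v : ℝ) (w : List ℝ) (σ : EvalState) :
    evalWord B (v :: w) σ = evalWord B w (σ.read (pick B (position v) 0) v) := rfl

theorem evalWord_append (B w w' : List ℝ) (σ : EvalState) :
    evalWord B (w ++ w') σ = evalWord B w' (evalWord B w σ) := List.foldl_append

theorem pick_of_neg (B : List ℝ) {u : ℝ} (b : ℝ) (hu : u < 0) : pick B u b = b := by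
  induction B generalizing u with
  | nil => rfl
  | cons x B ih => rw [pick, if_neg hu.ne, ih (by linarith)]

theorem pick_natCast (B : List ℝ) (i : ℕ) (b : ℝ) : pick B i b = B.getD i b := by
  induction B generalizing i with
  | nil => rfl
  | cons x B ih =>
    cases i with
    | zero => simp [pick, pick_of_neg]
    | succ i =>
      rw [pick, if_neg (Nat.cast_ne_zero.2 i.succ_ne_zero), Nat.cast_succ, add_sub_cancel_right, ih,
        List.getD_cons_succ]

/-- The real number that stands for a bit. -/
def bit (b : Bool) : ℝ := if b then 1 else 0

/-- The word `B`, extended by `0`, represents the assignment `c`. -/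
def Represents {n : ℕ} (B : List ℝ) (c : Fin n → Bool) : Prop :=
  ∀ i : Fin n, pick B (i : ℕ) 0 = bit (c i)

theorem represents_bits {n : ℕ} (y : List Bool) :
    Represents (bits y) fun i : Fin n => y.getD i false := fun i => by
  rw [pick_natCast]
  exact List.getD_map (l := y) (d := false) bit

theorem represents_ofFn {n : ℕ} (c : Fin n → Bool) : Represents (bits (List.ofFn c)) c := by
  simpa using represents_bits (n := n) (List.ofFn c)

section

variable {n : ℕ} {B : List ℝ} {c : Fin n → Bool}

/-- The rank of a binary vector in the lexicographic order. -/
def lexRank : (k : ℕ) → (Fin k → Bool) → ℕ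
  | 0, _ => 0
  | k + 1, v => (v 0).toNat * 2 ^ k + lexRank k (Fin.tail v)

theorem lexRank_lt (k : ℕ) (v : Fin k → Bool) : lexRank k v < 2 ^ k := by
  induction k with
  | zero => simp [lexRank]
  | succ k ih =>
    have h_tail := ih (Fin.tail v)
    rw [lexRank, pow_succ]
    cases v 0 <;> simp <;> lia

theorem table_getD_lexRank (k : ℕ) (f : (Fin k → Bool) → ℝ≥0) (v : Fin k → Bool) (d : ℝ) :
    (table k f).getD (lexRank k v) d = f v := by
  induction k with
  | zero => simp [table, lexRank, Subsingleton.elim v Fin.elim0]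
  | succ k ih =>
    have h_lt := lexRank_lt k (Fin.tail v)
    rw [table, lexRank]
    conv_rhs => rw [← Fin.cons_self_tail v]
    cases v 0 with
    | false =>
      rw [Bool.toNat_false, zero_mul, zero_add,
        List.getD_append _ _ _ _ (by simpa [table_length] using h_lt), ih]
    | true =>
      rw [Bool.toNat_true, one_mul, List.getD_append_right _ _ _ _ (by simp [table_length]),
        table_length, Nat.add_sub_cancel_left, ih]

theorem table_nonneg (k : ℕ) (f : (Fin k → Bool) → ℝ≥0) : ∀ v ∈ table k f, 0 ≤ v := by
  induction k with
  | zero => simp [table]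
  | succ k ih =>
    intro v hv
    rw [table, List.mem_append] at hv
    exact hv.elim (ih _ v) (ih _ v)

theorem evalWord_args (hB : Represents B c) (k : ℕ) (args : Fin k → Fin n) (σ : EvalState)
    (h_pending : σ.pending = k) (h_left : 0 < σ.left) :
    evalWord B (List.ofFn fun i => ((args i : ℕ) : ℝ)) σ =
      { σ with
        pending := 0
        index := σ.index * 2 ^ k + lexRank k fun i => c (args i)
        left := σ.left * 2 ^ k } := by
  induction k generalizing σ with
  | zero => ext <;> simp [evalWord, lexRank, h_pending]
  | succ k ih =>
    have h_one_le : 1 ≤ σ.pending := by simp [h_pending]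
    have h_nonneg : (0 : ℝ) ≤ (args 0 : ℕ) := Nat.cast_nonneg _
    have h_read : σ.read (pick B (position (args 0 : ℕ)) 0) (args 0 : ℕ) =
        { σ with
          index := σ.index + σ.index + bit (c (args 0))
          left := σ.left + σ.left
          pending := σ.pending - 1 } := by
      rw [EvalState.read, if_pos h_nonneg, if_neg h_left.not_ge, if_pos h_one_le, position,
        if_pos h_nonneg, hB]
    have h_bit : bit (c (args 0)) = (c (args 0)).toNat := by
      cases c (args 0) <;> simp [bit]
    have h_tail : (Fin.tail fun i => c (args i)) = fun i => c (args i.succ) := rfl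
    rw [List.ofFn_succ, evalWord_cons, h_read, ih (fun i => args i.succ) _ (by simp [h_pending])
      (by simpa using h_left)]
    ext <;> simp [lexRank, pow_succ, h_bit, h_tail] <;> ring

theorem evalWord_entries {l : List ℝ} (h_nonneg : ∀ v ∈ l, 0 ≤ v) (σ : EvalState)
    (h_pending : σ.pending < 1) (h_left : l.length ≤ σ.left) :
    evalWord B l σ =
      { σ with
        value := σ.value * pick l σ.index 1
        index := σ.index - l.length
        left := σ.left - l.length } := by
  induction l generalizing σ with
  | nil => simp [evalWord, pick]
  | cons v l ih =>
    rw [List.forall_mem_cons] at h_nonneg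
    rw [List.length_cons, Nat.cast_succ] at h_left ⊢
    have h_left_pos : 0 < σ.left := by linarith [Nat.cast_nonneg (α := ℝ) l.length]
    rw [evalWord_cons, EvalState.read, if_pos h_nonneg.1, if_neg h_left_pos.not_ge,
      if_neg h_pending.not_ge, pick]
    rw [ih h_nonneg.2 _ (by exact h_pending) (by exact le_sub_iff_add_le.2 h_left)]
    by_cases h_index : σ.index = 0
    · ext <;> simp [h_index, pick_of_neg] <;> ring
    · ext <;> simp [h_index] <;> ring

theorem evalWord_app (hB : Represents B c) (a : App n) (σ : EvalState) (h_left : σ.left = 0) :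
    (evalWord B a.encode σ).left = 0 ∧ (evalWord B a.encode σ).level = σ.level ∧
    (evalWord B a.encode σ).value = σ.value * a.con.val fun i => c (a.args i) := by
  rw [App.encode, evalWord_cons, evalWord_append, EvalState.read, if_pos (Nat.cast_nonneg _),
    if_pos h_left.le, evalWord_args hB _ _ _ rfl (by simp),
    evalWord_entries (table_nonneg _ _) _ (by simp) (by simp [table_length])]
  simp only [zero_mul, zero_add, one_mul, pick_natCast, table_getD_lexRank, table_length,
    Nat.cast_pow, Nat.cast_ofNat, sub_self, and_self]

/-- The product of the values of a list of applications. -/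
def valueOf (l : List (App n)) (c : Fin n → Bool) : ℝ :=
  (l.map fun a => ((a.con.val fun i => c (a.args i) : ℝ≥0) : ℝ)).prod

theorem evalWord_apps (hB : Represents B c) (l : List (App n)) (σ : EvalState)
    (h_left : σ.left = 0) :
    (evalWord B (l.flatMap App.encode) σ).level = σ.level ∧
    (evalWord B (l.flatMap App.encode) σ).value = σ.value * valueOf l c := by
  induction l generalizing σ with
  | nil => simp [evalWord, valueOf]
  | cons a l ih =>
    obtain ⟨h_left', h_level, h_value⟩ := evalWord_app hB a σ h_left
    rw [List.flatMap_cons, evalWord_append, (ih _ h_left').1, (ih _ h_left').2, h_level, h_value]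
    simp [valueOf, mul_assoc]

/-- The word of the parity check that contains the variables selected by `f`. -/
def rowWord {n : ℕ} (f : Fin n → Bool) : List ℝ :=
  (List.ofFn fun i : Fin n => if f i then [-((i : ℕ) + 1 : ℝ)] else []).flatten

/-- The word of a list of parity checks. -/
def hashWord {R n : ℕ} (g : Fin R → Fin n → Bool) : List ℝ :=
  (List.ofFn fun r => rowWord (g r) ++ [-(1 / 2)]).flatten

/-- The sign of a parity check at an assignment. -/
def parity {n : ℕ} (f c : Fin n → Bool) : ℝ := ∏ i, if f i && c i then -1 else 1

theorem evalWord_row (hB : Represents B c) (f : Fin n → Bool) (σ : EvalState) :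
    evalWord B (rowWord f) σ = { σ with sign := σ.sign * parity f c } := by
  rw [rowWord, parity, Fin.prod_univ_def, List.ofFn_eq_map]
  generalize List.finRange n = l
  induction l generalizing σ with
  | nil => simp [evalWord]
  | cons i l ih =>
    rw [List.map_cons, List.flatten_cons, evalWord_append, ih]
    cases hf : f i with
    | false => simp [evalWord, hf]
    | true =>
      have h_neg : ¬ (0 : ℝ) ≤ -((i : ℕ) + 1) := by
        have := Nat.cast_nonneg (α := ℝ) i
        linarith
      have h_position : position (-((i : ℕ) + 1)) = (i : ℕ) := by
        rw [position, if_neg h_neg]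
        ring
      rw [if_pos rfl, evalWord_cons, evalWord_nil, EvalState.read, if_neg h_neg, h_position,
        if_pos (Nat.cast_nonneg _), hB]
      cases hc : c i <;> simp [bit, hf, hc]

open Classical in
theorem evalWord_check (hB : Represents B c) (f : Fin n → Bool) (σ : EvalState)
    (h_sign : σ.sign = 1) :
    evalWord B (rowWord f ++ [-(1 / 2)]) σ =
      if 1 ≤ σ.alive ∧ 1 ≤ parity f c then { σ with level := σ.level + σ.level }
      else { σ with alive := 0 } := by
  have h_neg : ¬ (0 : ℝ) ≤ -(1 / 2) := by norm_num
  have h_position : ¬ (0 : ℝ) ≤ position (-(1 / 2)) := by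
    rw [position, if_neg h_neg]
    norm_num
  rw [evalWord_append, evalWord_row hB, evalWord_cons, evalWord_nil, EvalState.read, if_neg h_neg,
    if_neg h_position, h_sign, one_mul]

open Classical in
theorem evalWord_checks (hB : Represents B c) (l : List (Fin n → Bool)) (σ : EvalState)
    (h_sign : σ.sign = 1) :
    (evalWord B (l.map fun f => rowWord f ++ [-(1 / 2)]).flatten σ).level =
      (if 1 ≤ σ.alive then
        σ.level * 2 ^ (l.takeWhile fun f => decide (1 ≤ parity f c)).length else σ.level) ∧
    (evalWord B (l.map fun f => rowWord f ++ [-(1 / 2)]).flatten σ).value = σ.value ∧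
    (evalWord B (l.map fun f => rowWord f ++ [-(1 / 2)]).flatten σ).left = σ.left := by
  induction l generalizing σ with
  | nil => simp [evalWord]
  | cons f l ih =>
    rw [List.map_cons, List.flatten_cons, evalWord_append, evalWord_check hB f σ h_sign]
    by_cases h_alive : 1 ≤ σ.alive <;> by_cases h_pass : 1 ≤ parity f c
    · simp only [h_alive, h_pass, and_self, if_true]
      obtain ⟨h_level, h_rest⟩ := ih { σ with level := σ.level + σ.level } h_sign
      refine ⟨h_level.trans ?_, h_rest⟩
      simp only [h_alive, h_pass, if_true, decide_true, List.takeWhile_cons_of_pos,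
        List.length_cons, pow_succ]
      ring
    all_goals
      simp only [h_alive, h_pass, and_false, and_true, if_false]
      obtain ⟨h_level, h_rest⟩ := ih { σ with alive := 0 } h_sign
      exact ⟨h_level.trans (by simp [h_pass]), h_rest⟩

open Classical in
/-- The number of parity checks that an assignment passes before its first failure. -/
def passes {R : ℕ} (g : Fin R → Fin n → Bool) (c : Fin n → Bool) : ℕ :=
  ((List.ofFn g).takeWhile fun f => decide (1 ≤ parity f c)).length

theorem le_passes_iff {R : ℕ} (g : Fin R → Fin n → Bool) (c : Fin n → Bool) {j : ℕ}
    (hj : j ≤ R) : j ≤ passes g c ↔ ∀ r : Fin R, (r : ℕ) < j → 1 ≤ parity (g r) c := by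
  classical
  unfold passes
  induction R generalizing j with
  | zero => simp; lia
  | succ R ih =>
    rw [List.ofFn_succ, List.takeWhile_cons]
    cases j with
    | zero => simp
    | succ j =>
      rw [Fin.forall_fin_succ]
      by_cases h : 1 ≤ parity (g 0) c
      · simp [h, ih (fun r => g r.succ) (Nat.le_of_succ_le_succ hj)]
      · simp [h]

theorem evalWord_hash_apps (hB : Represents B c) {R : ℕ} (g : Fin R → Fin n → Bool)
    (l : List (App n)) :
    (evalWord B (hashWord g ++ l.flatMap App.encode) .init).level = 2 ^ passes g c ∧
    (evalWord B (hashWord g ++ l.flatMap App.encode) .init).value = valueOf l c := by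
  have h_word : hashWord g = ((List.ofFn g).map fun f => rowWord f ++ [-(1 / 2)]).flatten := by
    rw [hashWord, List.map_ofFn]
    rfl
  obtain ⟨h_level, h_value, h_left⟩ := evalWord_checks hB (List.ofFn g) .init rfl
  obtain ⟨h_level', h_value'⟩ := evalWord_apps hB l _ h_left
  rw [evalWord_append, h_word, h_level', h_value', h_level, h_value]
  simp [EvalState.init, passes]

/-- The instance of the target problem with threshold `T`, the parity checks `g` and the
applications `l`. -/
def query {R : ℕ} (T : ℝ) (g : Fin R → Fin n → Bool) (l : List (App n)) : List ℝ :=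
  T :: (hashWord g ++ l.flatMap App.encode)

open Classical in
theorem score_query (hB : Represents B c) {R : ℕ} (T : ℝ) (g : Fin R → Fin n → Bool)
    (l : List (App n)) :
    score (query T g l) B = if valueOf l c ≤ T then 1 else 2 ^ (passes g c + 1) := by
  obtain ⟨h_level, h_value⟩ := evalWord_hash_apps hB g l
  rw [score, query, List.tail_cons, List.headD_cons, h_level, h_value]
  simp [pow_succ, mul_comm]

end

/-! ## Isolation by random parity checks -/

section Isolation

open Finset
open scoped BigOperators

theorem average_prod {ι β : Type*} [Fintype ι] [DecidableEq ι] [Fintype β] (h : ι → β → ℝ) :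
    𝔼 g : ι → β, ∏ i, h i (g i) = ∏ i, 𝔼 b, h i b := by
  simp only [Fintype.expect_eq_sum_div_card, prod_div_distrib, Fintype.prod_sum, prod_const,
    Fintype.card_fun, Nat.cast_pow, card_univ]

theorem average_forall_lt {β : Type*} [Fintype β] [Nonempty β] {R j : ℕ} (hj : j ≤ R)
    (A : β → Prop) [DecidablePred A] :
    𝔼 g : Fin R → β, (if ∀ r : Fin R, (r : ℕ) < j → A (g r) then (1 : ℝ) else 0) =
      (𝔼 b, if A b then 1 else 0) ^ j := by
  have h_prod (g : Fin R → β) : (if ∀ r : Fin R, (r : ℕ) < j → A (g r) then (1 : ℝ) else 0) =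
      ∏ r : Fin R, if (r : ℕ) < j → A (g r) then 1 else 0 := by
    simp [prod_boole]
  have h_factor (r : Fin R) : (𝔼 b, if (r : ℕ) < j → A b then (1 : ℝ) else 0) =
      if (r : ℕ) < j then 𝔼 b, if A b then 1 else 0 else 1 := by
    by_cases hr : (r : ℕ) < j <;> simp [hr]
  rw [expect_congr rfl fun g _ => h_prod g,
    average_prod fun (r : Fin R) b => if (r : ℕ) < j → A b then (1 : ℝ) else 0]
  simp only [h_factor, prod_ite, prod_const, one_pow, mul_one, Fin.card_filter_val_lt,
    min_eq_right hj]

variable {n : ℕ}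

theorem parity_eq (f z : Fin n → Bool) : parity f z = 1 ∨ parity f z = -1 := by
  refine prod_induction _ (fun x : ℝ => x = 1 ∨ x = -1) ?_ (Or.inl rfl) fun i _ => ?_
  · rintro a b (rfl | rfl) (rfl | rfl) <;> simp
  · split_ifs <;> simp

theorem parity_mul (f y z : Fin n → Bool) :
    parity f y * parity f z = parity f fun i => xor (y i) (z i) := by
  simp only [parity, ← prod_mul_distrib]
  refine prod_congr rfl fun i _ => ?_
  beta_reduce
  cases f i <;> cases y i <;> cases z i <;> simp

theorem average_parity {z : Fin n → Bool} (hz : z ≠ fun _ => false) : 𝔼 f, parity f z = 0 := by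
  obtain ⟨i, hi⟩ := Function.ne_iff.1 hz
  have h_prod := average_prod fun (i : Fin n) b => if b && z i then (-1 : ℝ) else 1
  refine h_prod.trans (prod_eq_zero (mem_univ i) ?_)
  simp [Finset.expect, Bool.eq_true_of_not_eq_false hi]

theorem ite_one_le_parity (f z : Fin n → Bool) :
    (if 1 ≤ parity f z then (1 : ℝ) else 0) = (1 + parity f z) / 2 := by
  rcases parity_eq f z with h | h <;> norm_num [h]

theorem average_parity_check {z : Fin n → Bool} (hz : z ≠ fun _ => false) :
    (𝔼 f, if 1 ≤ parity f z then (1 : ℝ) else 0) = 1 / 2 := by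
  simp only [ite_one_le_parity, ← expect_div, expect_add_distrib, average_parity hz,
    Fintype.expect_one, add_zero]

theorem average_parity_check_and {y z : Fin n → Bool} (hy : y ≠ fun _ => false)
    (hz : z ≠ fun _ => false) (hyz : y ≠ z) :
    (𝔼 f, if 1 ≤ parity f y ∧ 1 ≤ parity f z then (1 : ℝ) else 0) = 1 / 4 := by
  have h_xor : (fun i => xor (y i) (z i)) ≠ fun _ => false := fun h =>
    hyz (funext fun i => by simpa using congrFun h i)
  have h_ite (f : Fin n → Bool) : (if 1 ≤ parity f y ∧ 1 ≤ parity f z then (1 : ℝ) else 0) =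
      (1 + parity f y + parity f z + parity f fun i => xor (y i) (z i)) / 4 := by
    rw [ite_and, ite_one_le_parity f z, ← parity_mul]
    rcases parity_eq f y with h | h <;> norm_num [h]
    ring
  simp only [h_ite, ← expect_div, expect_add_distrib, average_parity hy, average_parity hz,
    average_parity h_xor, Fintype.expect_one, add_zero]

theorem average_le_passes {R j : ℕ} (hj : j ≤ R) {z : Fin n → Bool} (hz : z ≠ fun _ => false) :
    (𝔼 g : Fin R → Fin n → Bool, if j ≤ passes g z then (1 : ℝ) else 0) = (1 / 2) ^ j := by
  rw [← average_parity_check hz, ← average_forall_lt hj]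
  exact expect_congr rfl fun g _ => if_congr (le_passes_iff g z hj) rfl rfl

theorem average_le_passes_and {R j : ℕ} (hj : j ≤ R) {y z : Fin n → Bool}
    (hy : y ≠ fun _ => false) (hz : z ≠ fun _ => false) (hyz : y ≠ z) :
    (𝔼 g : Fin R → Fin n → Bool, if j ≤ passes g y ∧ j ≤ passes g z then (1 : ℝ) else 0) =
      (1 / 4) ^ j := by
  rw [← average_parity_check_and hy hz hyz,
    ← average_forall_lt hj fun f => 1 ≤ parity f y ∧ 1 ≤ parity f z]
  refine expect_congr rfl fun g _ => if_congr ?_ rfl rfl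
  simp only [le_passes_iff _ _ hj, imp_and, forall_and]

/-- Among the assignments in `S`, only `z` passes the first `j` parity checks. -/
def Isolates {R : ℕ} (j : ℕ) (S : Finset (Fin n → Bool)) (g : Fin R → Fin n → Bool)
    (z : Fin n → Bool) : Prop :=
  j ≤ passes g z ∧ ∀ y ∈ S, j ≤ passes g y → y = z

instance {R j : ℕ} {S : Finset (Fin n → Bool)} {g : Fin R → Fin n → Bool} {z : Fin n → Bool} :
    Decidable (Isolates j S g z) := inferInstanceAs (Decidable (_ ∧ _))

theorem ite_le_passes_le {R : ℕ} (j : ℕ) (S : Finset (Fin n → Bool)) (g : Fin R → Fin n → Bool)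
    (z : Fin n → Bool) :
    (if j ≤ passes g z then (1 : ℝ) else 0) ≤ (if Isolates j S g z then 1 else 0) +
      ∑ y ∈ S.erase z, if j ≤ passes g y ∧ j ≤ passes g z then 1 else 0 := by
  have h_nonneg : ∀ y ∈ S.erase z, (0 : ℝ) ≤ if j ≤ passes g y ∧ j ≤ passes g z then 1 else 0 :=
    fun y _ => by split_ifs <;> norm_num
  by_cases hz : j ≤ passes g z
  · by_cases h_iso : Isolates j S g z
    · simp [hz, h_iso]
    · obtain ⟨y, hyS, hy, hyz⟩ : ∃ y ∈ S, j ≤ passes g y ∧ y ≠ z := by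
        simpa [Isolates, hz] using h_iso
      simpa [hz, h_iso, hy] using single_le_sum h_nonneg (mem_erase.2 ⟨hyz, hyS⟩)
  · simp [hz, Isolates]

theorem le_average_isolates {R j : ℕ} (hj : j ≤ R) {S : Finset (Fin n → Bool)}
    (hS : ∀ y ∈ S, y ≠ fun _ => false) {z : Fin n → Bool} (hz : z ∈ S) :
    (1 / 2) ^ j - #S * (1 / 4) ^ j ≤
      𝔼 g : Fin R → Fin n → Bool, if Isolates j S g z then (1 : ℝ) else 0 := by
  have h_le := expect_le_expect fun (g : Fin R → Fin n → Bool) (_ : g ∈ univ) =>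
    ite_le_passes_le j S g z
  have h_pairs : ∑ y ∈ S.erase z, 𝔼 g : Fin R → Fin n → Bool,
      (if j ≤ passes g y ∧ j ≤ passes g z then (1 : ℝ) else 0) ≤ #S * (1 / 4) ^ j := by
    rw [sum_congr rfl fun y hy => average_le_passes_and hj (hS y (mem_of_mem_erase hy)) (hS z hz)
      (ne_of_mem_erase hy), sum_const, nsmul_eq_mul]
    gcongr
    exact erase_subset z S
  rw [expect_add_distrib, expect_sum_comm, average_le_passes hj (hS z hz)] at h_le
  linarith

theorem one_div_eight_mul_le_sub {N x : ℝ} (hN : 0 < N) (h_lower : 2 * N ≤ x)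
    (h_upper : x ≤ 4 * N) :
    1 / (8 * N) ≤ 1 / x - N * (1 / x) ^ 2 := by
  have hx : 0 < x := by linarith
  have h_half : N * (1 / x) ≤ 1 / 2 := by
    rw [mul_one_div, div_le_div_iff₀ hx two_pos]
    linarith
  calc 1 / (8 * N) = 1 / (4 * N) * (1 / 2) := by
        field_simp
        norm_num
    _ ≤ 1 / x * (1 - N * (1 / x)) :=
        mul_le_mul (one_div_le_one_div_of_le hx h_upper) (by linarith) (by norm_num) (by positivity)
    _ = 1 / x - N * (1 / x) ^ 2 := by ring

/-- The witness is `j = log N + 2`, for which `2 ^ j` lies between `2 N` and `4 N`. -/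
theorem exists_le_average_isolates {S : Finset (Fin n → Bool)} (hS : ∀ y ∈ S, y ≠ fun _ => false)
    (hS_nonempty : S.Nonempty) :
    ∃ j, ∀ z ∈ S, 1 / (8 * (#S : ℝ)) ≤
      𝔼 g : Fin (n + 2) → Fin n → Bool, if Isolates j S g z then (1 : ℝ) else 0 := by
  have h_level : Nat.log 2 #S + 2 ≤ n + 2 := by
    simpa [Nat.log_pow] using Nat.log_mono_right (b := 2) (card_le_univ S)
  have h_upper : (2 : ℝ) ^ (Nat.log 2 #S + 2) ≤ 4 * #S := by
    rw [pow_add]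
    have : (2 : ℝ) ^ Nat.log 2 #S ≤ #S := by
      exact_mod_cast Nat.pow_log_le_self 2 hS_nonempty.card_ne_zero
    linarith
  have h_lower : 2 * (#S : ℝ) ≤ 2 ^ (Nat.log 2 #S + 2) := by
    rw [pow_succ']
    have : (#S : ℝ) ≤ 2 ^ (Nat.log 2 #S + 1) := by
      exact_mod_cast (Nat.lt_pow_succ_log_self one_lt_two _).le
    linarith
  have h_quarter (j : ℕ) : (1 / 4 : ℝ) ^ j = ((1 / 2) ^ j) ^ 2 := by
    rw [← pow_mul, mul_comm, pow_mul]
    norm_num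
  refine ⟨Nat.log 2 #S + 2, fun z hz => le_trans ?_ (le_average_isolates h_level hS hz)⟩
  rw [h_quarter, one_div_pow 2 (Nat.log 2 #S + 2)]
  exact one_div_eight_mul_le_sub (by exact_mod_cast hS_nonempty.card_pos) h_lower h_upper

end Isolation

/-! ## The random search -/

section Search

open Finset
open scoped BigOperators

variable {n : ℕ}

/-- The assignment that a word of reals stands for. -/
def toAssignment (n : ℕ) (z : List ℝ) : Fin n → Bool := fun i => decide (1 ≤ z.getD i 0)

theorem toAssignment_bits (y : List Bool) :
    toAssignment n (bits y) = fun i : Fin n => y.getD i false := by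
  funext i
  have h_bit : (bits y).getD i 0 = bit (y.getD i false) :=
    List.getD_map (l := y) (d := false) bit
  rw [toAssignment, h_bit]
  cases y.getD i false <;> norm_num [bit]

/-- The assignment after the answer `z` to a query made at the assignment `c`. -/
def advance (l : List (App n)) (c : Fin n → Bool) (z : List ℝ) : Fin n → Bool :=
  if valueOf l (toAssignment n z) ≤ valueOf l c then c else toAssignment n z

theorem valueOf_le_advance (l : List (App n)) (c : Fin n → Bool) (z : List ℝ) :
    valueOf l c ≤ valueOf l (advance l c z) := by
  unfold advance
  split_ifs with h
  · exact le_rfl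
  · exact (not_le.1 h).le

/-- The distribution of the assignment after one round that starts at the assignment `c`. -/
def roundDist (O : Oracle) (l : List (App n)) (c : Fin n → Bool) : PMF (Fin n → Bool) :=
  (PMF.uniformOfFintype (Fin (n + 2) → Fin n → Bool)).bind fun g =>
    (O (query (valueOf l c) g l) (1 / 2)).map (advance l c)

/-- The distribution of the assignment after `k` rounds that start at the assignment `c`. -/
def searchDist (O : Oracle) (l : List (App n)) : ℕ → (Fin n → Bool) → PMF (Fin n → Bool)
  | 0, c => PMF.pure c
  | k + 1, c => (roundDist O l c).bind (searchDist O l k)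

/-- The assignments that are better than `c`. -/
def better (l : List (App n)) (c : Fin n → Bool) : Finset (Fin n → Bool) :=
  {z | valueOf l c < valueOf l z}

theorem mem_better {l : List (App n)} {c z : Fin n → Bool} :
    z ∈ better l c ↔ valueOf l c < valueOf l z := by simp [better]

theorem better_subset {l : List (App n)} {c d : Fin n → Bool} (h : valueOf l c ≤ valueOf l d) :
    better l d ⊆ better l c := fun _ hz => mem_better.2 (h.trans_lt (mem_better.1 hz))

theorem card_better_add {l : List (App n)} {c d : Fin n → Bool}
    (h : valueOf l c ≤ valueOf l d) :
    #(better l d) + #{y ∈ better l c | valueOf l y ≤ valueOf l d} = #(better l c) := by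
  rw [← card_filter_add_card_filter_not (s := better l c) (fun y => valueOf l d < valueOf l y)]
  congr 2
  · ext y
    rw [mem_filter, mem_better]
    exact ⟨fun hy => ⟨mem_better.2 (h.trans_lt hy), hy⟩, And.right⟩
  · simp only [not_lt]

theorem card_sq_le_two_mul_sum {α β : Type*} [LinearOrder β] (S : Finset α) (v : α → β) :
    #S ^ 2 ≤ 2 * ∑ d ∈ S, #{y ∈ S | v y ≤ v d} := by
  have h_comm : ∑ d ∈ S, #{y ∈ S | v y ≤ v d} = ∑ d ∈ S, #{y ∈ S | v d ≤ v y} := by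
    simp only [card_filter]
    exact sum_comm
  calc #S ^ 2 = ∑ _d ∈ S, #S := by rw [sum_const, smul_eq_mul, sq]
    _ ≤ ∑ d ∈ S, (#{y ∈ S | v y ≤ v d} + #{y ∈ S | v d ≤ v y}) := by
        refine sum_le_sum fun d _ => ?_
        rw [← card_filter_add_card_filter_not (s := S) (fun y => v y ≤ v d)]
        gcongr
        exact fun h => (not_le.1 h).le
    _ = 2 * ∑ d ∈ S, #{y ∈ S | v y ≤ v d} := by rw [sum_add_distrib, ← h_comm, two_mul]

theorem le_hashWord_length {R : ℕ} (g : Fin R → Fin n → Bool) : R ≤ (hashWord g).length := by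
  simp [hashWord, List.length_flatten, List.map_ofFn, List.sum_ofFn, sum_add_distrib]

/-- The factor `2 ^ (1 / 2)` is less than `2`, so that a good answer has the optimal measure. -/
theorem advance_eq_of_isolates {l : List (App n)} {c d : Fin n → Bool} {j : ℕ}
    {g : Fin (n + 2) → Fin n → Bool} (h_iso : Isolates j (better l c) g d) (hd : d ∈ better l c)
    {y : List Bool}
    (hy : improvement.IsApprox ((2 : ℝ) ^ (1 / 2 : ℝ)) (query (valueOf l c) g l) y) :
    advance l c (bits y) = d := by
  have h_length : (List.ofFn d).length ≤ (query (valueOf l c) g l).length := by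
    have := le_hashWord_length g
    simp only [query, List.length_ofFn, List.length_cons, List.length_append]
    lia
  have h_ratio : (2 : ℝ) ^ (1 / 2 : ℝ) < 2 :=
    Real.rpow_lt_self_of_one_lt one_lt_two (by norm_num)
  have h_score : (2 : ℝ) ^ (passes g d + 1) < score (query (valueOf l c) g l) (bits y) * 2 := by
    have h_le := score_le_of_isApprox hy h_length
    rw [score_query (represents_ofFn d), if_neg (mem_better.1 hd).not_ge] at h_le
    exact h_le.trans_lt (mul_lt_mul_of_pos_left h_ratio (score_pos _ _))
  rw [score_query (represents_bits (n := n) y)] at h_score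
  rw [advance, toAssignment_bits]
  split_ifs at h_score with h_value
  · have : (1 : ℝ) ≤ 2 ^ passes g d := one_le_pow₀ one_le_two
    rw [pow_succ] at h_score
    linarith
  · rw [if_neg h_value]
    refine h_iso.2 _ (mem_better.2 (not_le.1 h_value)) ?_
    rw [← pow_succ, pow_lt_pow_iff_right₀ one_lt_two] at h_score
    have := h_iso.1
    lia

theorem mean_add_measure_mul_le {α : Type*} (p : PMF α) {f : α → ℝ≥0∞} {A : Set α} {x δ : ℝ≥0∞}
    (hf : ∀ a, f a ≤ x) (hA : ∀ a ∈ A, f a + δ ≤ x) :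
    mean p f + p.toOuterMeasure A * δ ≤ x := by
  rw [← mean_indicator, mul_comm, ← mean_mul_left, ← mean_add]
  refine (mean_mono p fun a => ?_).trans (mean_const p x).le
  by_cases ha : a ∈ A <;> simp [ha, hf, hA]

variable {l : List (App n)} {O : Oracle}

theorem mean_answer_le (hO : improvement.IsRandomizedScheme fun Y δ => O (improvement.encode Y) δ)
    (c : Fin n → Bool) (j : ℕ) (g : Fin (n + 2) → Fin n → Bool) :
    mean (O (query (valueOf l c) g l) (1 / 2)) (fun z => (#(better l (advance l c z)) : ℝ≥0∞)) +
      3 / 4 * ∑ d ∈ better l c, (if Isolates j (better l c) g d then 1 else 0) *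
        (#{y ∈ better l c | valueOf l y ≤ valueOf l d} : ℝ≥0∞) ≤ #(better l c) := by
  have h_le (z : List ℝ) : (#(better l (advance l c z)) : ℝ≥0∞) ≤ #(better l c) :=
    mod_cast card_le_card (better_subset (valueOf_le_advance l c z))
  by_cases h_iso : ∃ d ∈ better l c, Isolates j (better l c) g d
  · obtain ⟨d, hd, h_iso⟩ := h_iso
    rw [sum_eq_single_of_mem d hd fun e he hed => by
      rw [if_neg fun h => hed (h_iso.2 e he h.1), zero_mul], if_pos h_iso, one_mul]
    have h_scheme := hO (query (valueOf l c) g l) (1 / 2) (by norm_num) (by norm_num)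
    refine (add_le_add_right (mul_le_mul_left h_scheme _) _).trans
      (mean_add_measure_mul_le _ h_le ?_)
    rintro z ⟨y, rfl, hy⟩
    rw [advance_eq_of_isolates h_iso hd hy]
    exact_mod_cast (card_better_add (mem_better.1 hd).le).le
  · push Not at h_iso
    rw [sum_eq_zero fun d hd => by rw [if_neg (h_iso d hd), zero_mul], mul_zero, add_zero]
    exact (mean_mono _ h_le).trans (mean_const _ _).le

theorem mean_uniform_ite {α : Type*} [Fintype α] [Nonempty α] (A : α → Prop)
    [DecidablePred A] :
    mean (PMF.uniformOfFintype α) (fun a => if A a then 1 else 0) =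
      ENNReal.ofReal (𝔼 a, if A a then 1 else 0) := by
  rw [mean_uniform, Fintype.expect_eq_sum_div_card, ENNReal.ofReal_div_of_pos (by positivity),
    ENNReal.ofReal_natCast, sum_boole, sum_boole, ENNReal.ofReal_natCast, mul_comm,
    div_eq_mul_inv]

theorem mean_sum {α ι : Type*} (p : PMF α) (S : Finset ι) (f : ι → α → ℝ≥0∞) :
    (mean p fun a => ∑ i ∈ S, f i a) = ∑ i ∈ S, mean p (f i) := by
  simp only [mean, mul_sum]
  exact Summable.tsum_finsetSum fun _ _ => ENNReal.summable

theorem natCast_div_le_inv_mul {N K : ℕ} (hN : 0 < N) (h : N ^ 2 ≤ 2 * K) :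
    (N : ℝ≥0∞) / 16 ≤ (8 * N : ℝ≥0∞)⁻¹ * K := by
  have h_pos : (8 * N : ℝ≥0∞) ≠ 0 := by positivity
  rw [mul_comm _ (K : ℝ≥0∞), ← div_eq_mul_inv, ENNReal.le_div_iff_mul_le (.inl h_pos)
    (.inl (by finiteness)), ENNReal.div_eq_inv_mul, mul_assoc,
    ENNReal.inv_mul_le_iff (by norm_num) (by norm_num)]
  norm_cast
  nlinarith

theorem exists_card_div_le_mean_gain {c : Fin n → Bool}
    (hc : valueOf l (fun _ => false) ≤ valueOf l c) :
    ∃ j, (#(better l c) : ℝ≥0∞) / 16 ≤ mean (PMF.uniformOfFintype (Fin (n + 2) → Fin n → Bool))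
      fun g => ∑ d ∈ better l c, (if Isolates j (better l c) g d then 1 else 0) *
        (#{y ∈ better l c | valueOf l y ≤ valueOf l d} : ℝ≥0∞) := by
  set S := better l c
  obtain h_empty | h_nonempty := S.eq_empty_or_nonempty
  · simp [h_empty]
  have h_nonzero : ∀ y ∈ S, y ≠ fun _ => false := by
    rintro _ hy rfl
    exact (mem_better.1 hy).not_ge hc
  obtain ⟨j, hj⟩ := exists_le_average_isolates h_nonzero h_nonempty
  have h_isolated : ∀ d ∈ S, (8 * #S : ℝ≥0∞)⁻¹ ≤ ENNReal.ofReal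
      (𝔼 g : Fin (n + 2) → Fin n → Bool, if Isolates j S g d then (1 : ℝ) else 0) := by
    intro d hd
    convert! ENNReal.ofReal_le_ofReal (hj d hd) using 1
    rw [one_div, ENNReal.ofReal_inv_of_pos (by positivity), ENNReal.ofReal_mul (by norm_num)]
    simp
  refine ⟨j, ?_⟩
  calc (#S : ℝ≥0∞) / 16
      ≤ (8 * #S : ℝ≥0∞)⁻¹ * ∑ d ∈ S, (#{y ∈ S | valueOf l y ≤ valueOf l d} : ℝ≥0∞) :=
        mod_cast natCast_div_le_inv_mul h_nonempty.card_pos (card_sq_le_two_mul_sum S (valueOf l))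
    _ ≤ _ := by
        rw [mean_sum, mul_sum]
        refine sum_le_sum fun d hd => ?_
        simp only [mul_comm _ (#{y ∈ S | valueOf l y ≤ valueOf l d} : ℝ≥0∞)]
        rw [mean_mul_left, mean_uniform_ite]
        exact mul_le_mul_right (h_isolated d hd) _

theorem mean_roundDist_le
    (hO : improvement.IsRandomizedScheme fun Y δ => O (improvement.encode Y) δ)
    {c : Fin n → Bool} (hc : valueOf l (fun _ => false) ≤ valueOf l c) :
    mean (roundDist O l c) (fun d => (#(better l d) : ℝ≥0∞)) ≤ (61 / 64 : ℝ≥0) * #(better l c) := by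
  obtain ⟨j, hj⟩ := exists_card_div_le_mean_gain hc
  have h_rate : (61 / 64 : ℝ≥0) * (#(better l c) : ℝ≥0∞) + 3 / 4 * (#(better l c) / 16) =
      #(better l c) := by
    have h_gain : (3 / 4 * 16⁻¹ : ℝ≥0∞) = (3 / 64 : ℝ≥0) := by
      rw [← ENNReal.toReal_eq_toReal_iff' (by finiteness) (by finiteness)]
      norm_num
    have h_sum : (61 / 64 + 3 / 64 : ℝ≥0) = 1 := by norm_num
    rw [ENNReal.div_eq_inv_mul (b := 16), ← mul_assoc, h_gain, ← add_mul, ← ENNReal.coe_add, h_sum,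
      ENNReal.coe_one, one_mul]
  have h_round := (mean_mono (PMF.uniformOfFintype (Fin (n + 2) → Fin n → Bool))
    (mean_answer_le (l := l) hO c j)).trans (mean_const _ _).le
  rw [mean_add, mean_mul_left] at h_round
  rw [← ENNReal.add_le_add_iff_right (a := 3 / 4 * ((#(better l c) : ℝ≥0∞) / 16)) (by finiteness),
    h_rate, roundDist, mean_bind]
  simp only [mean_map]
  exact (add_le_add_right (mul_le_mul_right hj _) _).trans h_round

theorem valueOf_le_of_mem_support {c d : Fin n → Bool} (hd : d ∈ (roundDist O l c).support) :
    valueOf l c ≤ valueOf l d := by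
  simp only [roundDist, PMF.mem_support_bind_iff, PMF.mem_support_map_iff] at hd
  obtain ⟨g, -, z, -, rfl⟩ := hd
  exact valueOf_le_advance l c z

theorem mean_searchDist_le
    (hO : improvement.IsRandomizedScheme fun Y δ => O (improvement.encode Y) δ) (k : ℕ)
    {c : Fin n → Bool} (hc : valueOf l (fun _ => false) ≤ valueOf l c) :
    mean (searchDist O l k c) (fun d => (#(better l d) : ℝ≥0∞)) ≤
      (61 / 64 : ℝ≥0) ^ k * #(better l c) := by
  induction k generalizing c with
  | zero => rw [searchDist, mean_pure, pow_zero, one_mul]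
  | succ k ih =>
    rw [searchDist, mean_bind]
    calc _ ≤ mean (roundDist O l c) fun d => (61 / 64 : ℝ≥0) ^ k * (#(better l d) : ℝ≥0∞) :=
          mean_mono_of_mem_support _ fun d hd => ih (hc.trans (valueOf_le_of_mem_support hd))
      _ ≤ (61 / 64 : ℝ≥0) ^ k * ((61 / 64 : ℝ≥0) * #(better l c)) := by
          rw [mean_mul_left]
          exact mul_le_mul_right (mean_roundDist_le hO hc) _
      _ = (61 / 64 : ℝ≥0) ^ (k + 1) * #(better l c) := by rw [pow_succ, mul_assoc]

/-- Markov's inequality for the number of better assignments. -/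
theorem three_quarters_le_searchDist
    (hO : improvement.IsRandomizedScheme fun Y δ => O (improvement.encode Y) δ) :
    3 / 4 ≤ (searchDist O l (16 * (n + 2)) fun _ => false).toOuterMeasure
      {c : Fin n → Bool | ∀ d, valueOf l d ≤ valueOf l c} := by
  set p := searchDist O l (16 * (n + 2)) fun _ => false
  set best := {c : Fin n → Bool | ∀ d, valueOf l d ≤ valueOf l c}
  have h_better (c : Fin n → Bool) : 1 ≤ best.indicator 1 c + (#(better l c) : ℝ≥0∞) := by
    by_cases hc : c ∈ best
    · simp [hc]
    · obtain ⟨d, hd⟩ := not_forall.1 hc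
      have h_pos : 0 < #(better l c) := card_pos.2 ⟨d, mem_better.2 (not_le.1 hd)⟩
      exact le_add_left (mod_cast h_pos)
  have h_mean : mean p (fun c => (#(better l c) : ℝ≥0∞)) ≤ (1 / 4 : ℝ≥0) := by
    refine (mean_searchDist_le hO _ le_rfl).trans ?_
    have h_card : #(better l fun _ : Fin n => false) ≤ 2 ^ n := by
      simpa using card_le_univ (better l fun _ : Fin n => false)
    have h_rate : (61 / 64 : ℝ≥0) ^ 16 ≤ 1 / 2 := by
      rw [← NNReal.coe_le_coe]
      norm_num
    norm_cast
    calc _ ≤ (1 / 2 : ℝ≥0) ^ (n + 2) * 2 ^ n := by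
          rw [pow_mul]
          gcongr
          exact_mod_cast h_card
      _ = 1 / 4 := by
          rw [pow_add, mul_right_comm, ← mul_pow]
          norm_num
  have h_total := (mean_const p 1).ge.trans (mean_mono p h_better)
  rw [mean_add, mean_indicator] at h_total
  have h_sum : (3 / 4 + (1 / 4 : ℝ≥0) : ℝ≥0∞) = 1 := by
    rw [ENNReal.coe_div four_ne_zero, ENNReal.coe_one, ENNReal.coe_ofNat, ENNReal.div_add_div_same,
      ENNReal.div_eq_one_iff (by norm_num) (by norm_num)]
    norm_num
  rw [← ENNReal.add_le_add_iff_right (a := ((1 / 4 : ℝ≥0) : ℝ≥0∞)) (by finiteness), h_sum]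
  exact h_total.trans (add_le_add_right h_mean _)

end Search

/-! ## Programs of the reduction -/

section Hashing

variable {O : Oracle} {s : Store} {n : ℕ}

theorem uniformOfFintype_snoc {α : Type*} [Fintype α] [Nonempty α] (k : ℕ) :
    PMF.uniformOfFintype (Fin (k + 1) → α) = (PMF.uniformOfFintype α).bind fun x =>
      (PMF.uniformOfFintype (Fin k → α)).map fun f => (Fin.snoc f x : Fin (k + 1) → α) := by
  classical
  ext f
  rw [PMF.bind_apply, tsum_eq_single (f (Fin.last k)), PMF.map_apply, tsum_eq_single (Fin.init f)]
  · simp [PMF.uniformOfFintype_apply, pow_succ', ENNReal.mul_inv]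
  · intro g hg
    refine if_neg fun h => hg ?_
    rw [h, Fin.init_snoc]
  · intro x hx
    refine mul_eq_zero_of_right _ ((PMF.apply_eq_zero_iff _ _).2 fun h => hx ?_)
    obtain ⟨g, -, rfl⟩ := (PMF.mem_support_map_iff _ _ _).1 h
    exact (Fin.snoc_last (α := fun _ => α) _ _).symm

theorem uniformOfFintype_eq_pure {α : Type*} [Fintype α] [Unique α] :
    PMF.uniformOfFintype α = PMF.pure default := by
  ext x
  simp [Unique.eq_default x]

theorem rowWord_snoc (f : Fin n → Bool) (b : Bool) :
    rowWord (Fin.snoc f b : Fin (n + 1) → Bool) =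
      rowWord f ++ if b then [-((n : ℝ) + 1)] else [] := by
  rw [rowWord, List.ofFn_succ', List.concat_eq_append, List.flatten_append]
  simp [rowWord]

theorem hashWord_snoc {R : ℕ} (g : Fin R → Fin n → Bool) (f : Fin n → Bool) :
    hashWord (Fin.snoc g f : Fin (R + 1) → Fin n → Bool) =
      hashWord g ++ (rowWord f ++ [-(1 / 2)]) := by
  rw [hashWord, List.ofFn_succ', List.concat_eq_append, List.flatten_append]
  simp [hashWord]

theorem rowWord_length_le (f : Fin n → Bool) : (rowWord f).length ≤ n := by
  induction n with
  | zero => simp [rowWord]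
  | succ n ih =>
    rw [← Fin.snoc_init_self f, rowWord_snoc, List.length_append]
    exact Nat.add_le_add (ih _) (by split_ifs <;> simp)

theorem hashWord_length_le {R : ℕ} (g : Fin R → Fin n → Bool) :
    (hashWord g).length ≤ R * (n + 1) := by
  induction R with
  | zero => simp [hashWord]
  | succ R ih =>
    rw [← Fin.snoc_init_self g, hashWord_snoc, List.length_append, List.length_append, add_one_mul]
    exact Nat.add_le_add (ih _) (Nat.add_le_add_right (rowWord_length_le _) 1)

theorem Store.HasConstants.le_one_holds_iff (hs : s.HasConstants) {r i : ℕ} (hi : s.reg r = i) :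
    (Test.le Reg.one r).Holds s ↔ 1 ≤ i := by
  rw [Test.Holds, hs.one, hi, Nat.one_le_cast]

def flipRest : Prog :=
  .seq
    (.ite (.le Reg.one Reg.scratch)
      (instrs [.sub Reg.countdown Reg.zero Reg.varCount, .push Stk.word Reg.countdown]) .skip)
    (instrs [.sub Reg.varCount Reg.varCount Reg.one])

def flipBody : Prog := .seq (.flip Reg.scratch) flipRest

/-- Push the word of a random parity check. -/
def flipLoop : Prog := .loop (.le Reg.one Reg.varCount) flipBody

theorem flipBody_draws (hs : s.HasConstants) :
    Draws O flipBody s 11 (PMF.uniformOfFintype Bool) fun b s' =>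
      s'.stk Stk.word = (if b then [-s.reg Reg.varCount] else []) ++ s.stk Stk.word ∧
      s'.reg Reg.varCount = s.reg Reg.varCount - 1 := by
  have : flipRest.nodes = 7 := rfl
  refine ((Draws.flip _).seq_reaches (t₂ := 9) fun b s' hs' _ =>
    (Reaches.of_straight (P := flipRest) s').mono (by lia) ?_).mono le_rfl fun _ _ h _ => h
  subst hs'
  rintro _ rfl -
  cases b <;> simp [flipRest, instrs, Prog.effect, Instr.exec, Test.Holds, hs.zero, hs.one,
    (zero_lt_one' ℝ).not_ge]

theorem flipLoop_draws (hs : s.HasConstants) {i : ℕ} (hi : s.reg Reg.varCount = i) :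
    Draws O flipLoop s (12 * i + 1) (PMF.uniformOfFintype (Fin i → Bool)) fun f s' =>
      s'.stk Stk.word = rowWord f ++ s.stk Stk.word := by
  induction i generalizing s with
  | zero =>
    have h_end : ¬ (Test.le Reg.one Reg.varCount).Holds s := by
      simp [hs.le_one_holds_iff hi]
    rw [uniformOfFintype_eq_pure]
    refine Reaches.draws ((Reaches.loop_false h_end).mono le_rfl ?_)
    rintro _ rfl -
    simp [rowWord]
  | succ i ih =>
    rw [uniformOfFintype_snoc]
    refine ((flipBody_draws hs).loop_true ((hs.le_one_holds_iff hi).2 (by lia))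
      fun b s' hb hF => ?_).mono (t := 11 + (12 * i + 1) + 1) (by lia) fun _ _ h _ => h
    refine Draws.map ((ih (hs.of_frame hF) (by simp [hb.2, hi])).mono le_rfl fun f s'' h _ => ?_)
    rw [h, hb.1, hi, rowWord_snoc, List.append_assoc, Nat.cast_succ]

def rowBody : Prog :=
  .seq (instrs [.push Stk.word Reg.marker, .copy Reg.varCount Reg.numVars]) <|
  .seq flipLoop (instrs [.sub Reg.checkCount Reg.checkCount Reg.one])

/-- Push the words of random parity checks. -/
def hashLoop : Prog := .loop (.le Reg.one Reg.checkCount) rowBody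

/-- The registers that do not change during the search. -/
structure Store.HasParams (s : Store) (n : ℕ) : Prop extends s.HasConstants where
  numVars : s.reg Reg.numVars = n
  half : s.reg Reg.half = 1 / 2
  marker : s.reg Reg.marker = -(1 / 2)

theorem Store.HasParams.of_frame {s s' : Store} {P : Prog} (hs : s.HasParams n)
    (h : P.Frame s s') (h0 : Reg.zero ∉ P.regs := by decide)
    (h1 : Reg.one ∉ P.regs := by decide) (h2 : Reg.numVars ∉ P.regs := by decide)
    (h3 : Reg.half ∉ P.regs := by decide) (h4 : Reg.marker ∉ P.regs := by decide) :
    s'.HasParams n :=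
  ⟨hs.toHasConstants.of_frame h h0 h1, (h.reg _ h2).trans hs.numVars, (h.reg _ h3).trans hs.half,
    (h.reg _ h4).trans hs.marker⟩

theorem rowBody_draws (hs : s.HasParams n) :
    Draws O rowBody s (12 * n + 7) (PMF.uniformOfFintype (Fin n → Bool)) fun f s' =>
      s'.stk Stk.word = rowWord f ++ -(1 / 2) :: s.stk Stk.word ∧
      s'.reg Reg.checkCount = s.reg Reg.checkCount - 1 := by
  refine Draws.mono (t := 3 + (12 * n + 1 + 1 + 1) + 1) ((Reaches.of_straight s).seq
    fun s₁ h₁ hF₁ => (flipLoop_draws (hs.toHasConstants.of_frame hF₁) (i := n) ?_).seq_reaches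
      fun f s₂ h₂ hF₂ => (Reaches.of_straight s₂).mono le_rfl
        (B := fun s' => s'.stk Stk.word = rowWord f ++ -(1 / 2) :: s.stk Stk.word ∧
          s'.reg Reg.checkCount = s.reg Reg.checkCount - 1) ?_) (by lia) fun _ _ h _ => h
  · subst h₁
    simp [instrs, Prog.effect, Instr.exec, hs.numVars]
  · rintro _ rfl -
    have h_word : s₁.stk Stk.word = -(1 / 2) :: s.stk Stk.word := by
      subst h₁
      simp [instrs, Prog.effect, Instr.exec, hs.marker]
    have h_one := ((hs.toHasConstants.of_frame hF₁).of_frame hF₂).one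
    have h_count := (hF₂.reg Reg.checkCount).trans (hF₁.reg Reg.checkCount)
    simp [instrs, Prog.effect, Instr.exec, h₂, h_word, h_one, h_count]

theorem hashLoop_draws (hs : s.HasParams n) {R : ℕ} (hR : s.reg Reg.checkCount = R) :
    Draws O hashLoop s ((12 * n + 8) * R + 1) (PMF.uniformOfFintype (Fin R → Fin n → Bool))
      fun g s' => s'.stk Stk.word = hashWord g ++ s.stk Stk.word := by
  induction R generalizing s with
  | zero =>
    have h_end : ¬ (Test.le Reg.one Reg.checkCount).Holds s := by
      simp [hs.le_one_holds_iff hR]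
    rw [uniformOfFintype_eq_pure]
    refine Reaches.draws ((Reaches.loop_false h_end).mono le_rfl ?_)
    rintro _ rfl -
    simp [hashWord]
  | succ R ih =>
    rw [uniformOfFintype_snoc]
    refine ((rowBody_draws hs).loop_true ((hs.le_one_holds_iff hR).2 (by lia))
      fun f s' hf hF => ?_).mono (t := 12 * n + 7 + ((12 * n + 8) * R + 1) + 1) (by lia)
        fun _ _ h _ => h
    refine Draws.map ((ih (hs.of_frame hF) (by simp [hf.2, hR])).mono le_rfl fun g s'' h _ => ?_)
    simp [h, hf.1, hashWord_snoc]

end Hashing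

section Reading

variable {O : Oracle} {s : Store} {n : ℕ}

def roundingBody : Prog :=
  .seq (instrs [.pop Reg.scratch Stk.answer]) <|
  .seq
    (.ite (.le Reg.one Reg.scratch) (instrs [.push Stk.spare Reg.one])
      (instrs [.push Stk.spare Reg.zero]))
    (instrs [.sub Reg.varCount Reg.varCount Reg.one])

/-- Round the answer of the oracle to an assignment. -/
def roundingLoop : Prog := .loop (.le Reg.one Reg.varCount) roundingBody

theorem bits_toAssignment_succ (i : ℕ) (z : List ℝ) :
    bits (List.ofFn (toAssignment (i + 1) z)) =
      (if 1 ≤ z.headD 0 then 1 else 0) :: bits (List.ofFn (toAssignment i z.tail)) := by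
  have h_tail : toAssignment i z.tail = fun j => toAssignment (i + 1) z j.succ := by
    funext j
    simp [toAssignment]
  rw [h_tail, List.ofFn_succ]
  cases z <;> simp [bits, toAssignment]

theorem roundingBody_reaches (hs : s.HasConstants) :
    Reaches O roundingBody s 7 fun s' =>
      s'.stk Stk.spare = (if 1 ≤ (s.stk Stk.answer).headD 0 then 1 else 0) :: s.stk Stk.spare ∧
      s'.stk Stk.answer = (s.stk Stk.answer).tail ∧
      s'.reg Reg.varCount = s.reg Reg.varCount - 1 := by
  have h_nodes : roundingBody.nodes = 7 := rfl
  refine (Reaches.of_straight s).mono h_nodes.le ?_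
  rintro _ rfl -
  by_cases h : 1 ≤ (s.stk Stk.answer).head?.getD 0 <;>
    simp [roundingBody, instrs, Prog.effect, Instr.exec, Test.Holds, hs.zero, hs.one, h]

theorem roundingLoop_reaches (hs : s.HasConstants) {i : ℕ} (hi : s.reg Reg.varCount = i) :
    Reaches O roundingLoop s (8 * i + 1) fun s' => s'.stk Stk.spare =
      (bits (List.ofFn (toAssignment i (s.stk Stk.answer)))).reverse ++ s.stk Stk.spare := by
  induction i generalizing s with
  | zero =>
    refine (Reaches.loop_false (by simp [hs.le_one_holds_iff hi])).mono le_rfl ?_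
    rintro _ rfl -
    simp [bits]
  | succ i ih =>
    refine (Reaches.loop_true ((hs.le_one_holds_iff hi).2 (by lia)) (roundingBody_reaches hs)
      fun s' h hF => (ih (hs.of_frame hF) (by simp [h.2.2, hi])).mono le_rfl
        fun s'' h' _ => ?_).mono (by lia) fun _ _ h _ => h
    rw [h', h.1, h.2.1, bits_toAssignment_succ, List.reverse_cons, List.append_assoc]
    rfl

def restoreBody : Prog :=
  .seq (instrs [.pop Reg.scratch Stk.done])
    (.ite (.le Reg.zero Reg.scratch) (instrs [.push Stk.word Reg.scratch]) .skip)

/-- Move the nonnegative letters that have been read back to the word. -/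
def restoreLoop : Prog := .loop (.neg (.empty Stk.done)) restoreBody

open Classical in
theorem restoreLoop_reaches (hs : s.HasConstants) :
    Reaches O restoreLoop s (6 * (s.stk Stk.done).length + 1) fun s' =>
      s'.stk Stk.done = [] ∧ s'.stk Stk.word =
        ((s.stk Stk.done).filter fun x => 0 ≤ x).reverse ++ s.stk Stk.word := by
  refine (Reaches.loop_stack
    (fun l s' => (l.filter fun x => 0 ≤ x).reverse ++ s'.stk Stk.word =
      ((s.stk Stk.done).filter fun x => 0 ≤ x).reverse ++ s.stk Stk.word) rfl
    fun x l s' hF hl hI => (Reaches.of_straight s').mono le_rfl ?_).mono le_rfl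
      fun s' h _ => ⟨h.1, by simpa using h.2⟩
  rintro _ rfl -
  have h_zero := (hs.of_frame hF).zero
  rw [← hI]
  by_cases hx : 0 ≤ x <;>
    simp [restoreBody, instrs, Prog.effect, Instr.exec, Test.Holds, h_zero, hl, hx]

theorem App.encode_nonneg (a : App n) : ∀ x ∈ a.encode, 0 ≤ x := by
  intro x hx
  simp only [App.encode, List.mem_cons, List.mem_append, List.mem_ofFn] at hx
  obtain rfl | ⟨i, rfl⟩ | hx := hx
  · positivity
  · positivity
  · exact table_nonneg _ _ x hx

theorem neg_of_mem_hashWord {R : ℕ} (g : Fin R → Fin n → Bool) : ∀ x ∈ hashWord g, x < 0 := by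
  simp only [hashWord, rowWord, List.mem_flatten, List.mem_ofFn]
  rintro x ⟨_, ⟨r, rfl⟩, hx⟩
  simp only [List.mem_append, List.mem_flatten, List.mem_ofFn, List.mem_singleton] at hx
  obtain ⟨_, ⟨i, rfl⟩, hx⟩ | rfl := hx
  · split_ifs at hx
    · rw [List.mem_singleton.1 hx]
      exact neg_neg_of_pos (by positivity)
    · simp at hx
  · norm_num

open Classical in
theorem filter_hashWord_append {R : ℕ} (g : Fin R → Fin n → Bool) (l : List (App n)) :
    ((hashWord g ++ l.flatMap App.encode).filter fun x => 0 ≤ x) = l.flatMap App.encode := by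
  rw [List.filter_append, List.filter_eq_nil_iff.2, List.filter_eq_self.2, List.nil_append]
  · intro x hx
    obtain ⟨a, -, hx⟩ := List.mem_flatMap.1 hx
    exact decide_eq_true (a.encode_nonneg x hx)
  · intro x hx
    simpa using neg_of_mem_hashWord g x hx

/-- Evaluate the word and remove the parity checks from it. -/
def testProg : Prog := .seq evalProg restoreLoop

theorem testProg_reaches {R : ℕ} (g : Fin R → Fin n → Bool) (l : List (App n))
    (c : Fin n → Bool) (hs : s.HasConstants)
    (h_word : s.stk Stk.word = hashWord g ++ l.flatMap App.encode)
    (h_assignment : s.stk Stk.assignment = bits (List.ofFn c))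
    (h_spare : s.stk Stk.spare = []) (h_done : s.stk Stk.done = []) :
    Reaches O testProg s
      ((18 * n + 87) * (R * (n + 1) + (l.flatMap App.encode).length) + 19) fun s' =>
        s'.reg Reg.value = valueOf l c ∧ s'.stk Stk.word = l.flatMap App.encode ∧
        s'.stk Stk.assignment = bits (List.ofFn c) ∧ s'.stk Stk.spare = [] ∧
        s'.stk Stk.done = [] := by
  have h_length : (s.stk Stk.word).length ≤ R * (n + 1) + (l.flatMap App.encode).length := by
    rw [h_word, List.length_append]
    exact Nat.add_le_add_right (hashWord_length_le g) _
  have h_eval := evalProg_reaches (O := O) hs h_spare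
  have h_bits : (bits (List.ofFn c)).length = n := by simp [bits]
  rw [h_assignment, h_done, List.append_nil, h_bits] at h_eval
  refine (h_eval.seq (t₂ := 6 * (s.stk Stk.word).length + 1) ?_).mono (by nlinarith)
    fun _ _ h _ => h
  rintro s' ⟨h_state, h_word', h_done', h_assignment', h_spare'⟩ hF
  refine (restoreLoop_reaches (hs.of_frame hF)).mono (by simp [h_done']) fun s'' h hF' =>
    ⟨?_, ?_, (hF'.stk Stk.assignment).trans h_assignment', (hF'.stk Stk.spare).trans h_spare',
      h.1⟩
  · rw [hF'.reg Reg.value, ← (evalWord_hash_apps (represents_ofFn c) g l).2, ← h_word, ← h_state]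
    rfl
  · rw [h.2, h_word', h_done', List.append_nil, ← List.filter_reverse, List.reverse_reverse,
      h_word, filter_hashWord_append]

end Reading

section SearchProgram

variable {O : Oracle} {s : Store} {n : ℕ} {l : List (App n)} {c d : Fin n → Bool} {w : List ℝ}
  {j : ℝ}

/-- The memory during the search: `c` is the current assignment, `w` and `a` are the contents of the
stacks for the word and for the assignment to be tried, and `j` is the number of rounds to come. -/
structure SearchState (l : List (App n)) (c : Fin n → Bool) (w a : List ℝ) (j : ℝ) (s : Store) :
    Prop extends s.HasParams n where
  word : s.stk Stk.word = w
  current : s.stk Stk.current = bits (List.ofFn c)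
  assignment : s.stk Stk.assignment = a
  spare : s.stk Stk.spare = []
  done : s.stk Stk.done = []
  threshold : s.reg Reg.threshold = valueOf l c
  rounds : s.reg Reg.rounds = j

def swapProg : Prog :=
  .seq (instrs [.copy Reg.threshold Reg.value]) <|
  .seq (moveAll Stk.current Stk.discard) <|
  .seq (moveAll Stk.assignment Stk.spare) (moveAll Stk.spare Stk.current)

/-- Replace the current assignment by the one that has been tried if that has a larger value. -/
def replaceProg : Prog :=
  .seq (.ite (.le Reg.value Reg.threshold) (moveAll Stk.assignment Stk.discard) swapProg)
    (instrs [.sub Reg.rounds Reg.rounds Reg.one])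

theorem swapProg_reaches (hs : SearchState l c w (bits (List.ofFn d)) j s)
    (h_value : s.reg Reg.value = valueOf l d) :
    Reaches O swapProg s (12 * n + 7) (SearchState l d w [] j) := by
  have h_length : ∀ f : Fin n → Bool, (bits (List.ofFn f)).length = n := by simp [bits]
  refine Reaches.mono (t := 1 + ((4 * n + 1) + ((4 * n + 1) + (4 * n + 1) + 1) + 1) + 1)
    ((Reaches.of_straight s).seq fun s₁ h₁ hF₁ =>
      ((moveAll_reaches (by decide) s₁).mono ?_ fun _ h _ => h).seq fun s₂ h₂ hF₂ =>
      ((moveAll_reaches (by decide) s₂).mono ?_ fun s₃ h₃ _ => ⟨h₃.1, h₃.2.trans ?_⟩).seq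
        (A := fun s₃ => s₃.stk Stk.assignment = [] ∧
          s₃.stk Stk.spare = (bits (List.ofFn d)).reverse) fun s₃ h₃ hF₃ =>
      (moveAll_reaches (by decide) s₃).mono ?_ fun s₄ h₄ hF₄ => ?_) (by lia) fun _ h _ => h
  · rw [hF₁.stk Stk.current, hs.current, h_length]
  · rw [(hF₁.seq hF₂).stk Stk.assignment, hs.assignment, h_length]
  · rw [h₃.2, List.length_reverse, h_length]
  · have hF := hF₁.seq (hF₂.seq (hF₃.seq hF₄))
    have h_threshold : s₁.reg Reg.threshold = s.reg Reg.value := by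
      subst h₁
      simp [instrs, Prog.effect, Instr.exec]
    exact {
      toHasParams := hs.toHasParams.of_frame hF
      word := (hF.stk _).trans hs.word
      current := by
        rw [h₄.2, h₃.2, List.reverse_reverse, hF₃.stk Stk.current, h₂.1, List.append_nil]
      assignment := (hF₄.stk _).trans h₃.1
      spare := h₄.1
      done := (hF.stk _).trans hs.done
      threshold := by
        rw [((hF₂.seq (hF₃.seq hF₄)).reg Reg.threshold), h_threshold, h_value]
      rounds := (hF.reg _).trans hs.rounds }
  · rw [(hF₁.seq hF₂).stk Stk.assignment, (hF₁.seq hF₂).stk Stk.spare, hs.assignment, hs.spare,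
      List.append_nil]

theorem SearchState.sub_rounds (hs : SearchState l c w [] (j + 1) s) :
    Reaches O (instrs [.sub Reg.rounds Reg.rounds Reg.one]) s 1 (SearchState l c w [] j) := by
  refine (Reaches.of_straight s).mono le_rfl ?_
  rintro _ rfl hF
  exact {
    toHasParams := hs.toHasParams.of_frame hF
    word := hs.word
    current := hs.current
    assignment := hs.assignment
    spare := hs.spare
    done := hs.done
    threshold := (hF.reg _).trans hs.threshold
    rounds := by simp [instrs, Prog.effect, Instr.exec, hs.rounds, hs.one] }

theorem discardProg_reaches (hs : SearchState l c w (bits (List.ofFn d)) j s) :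
    Reaches O (moveAll Stk.assignment Stk.discard) s (4 * n + 1) (SearchState l c w [] j) := by
  refine (moveAll_reaches (by decide) s).mono (by simp [hs.assignment, bits]) fun s' h hF => ?_
  exact {
    toHasParams := hs.toHasParams.of_frame hF
    word := (hF.stk _).trans hs.word
    current := (hF.stk _).trans hs.current
    assignment := h.1
    spare := (hF.stk _).trans hs.spare
    done := (hF.stk _).trans hs.done
    threshold := (hF.reg _).trans hs.threshold
    rounds := (hF.reg _).trans hs.rounds }

open Classical in
theorem replaceProg_reaches (hs : SearchState l c w (bits (List.ofFn d)) (j + 1) s)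
    (h_value : s.reg Reg.value = valueOf l d) :
    Reaches O replaceProg s (12 * n + 10)
      (SearchState l (if valueOf l d ≤ valueOf l c then c else d) w [] j) := by
  have h_test : (Test.le Reg.value Reg.threshold).Holds s ↔ valueOf l d ≤ valueOf l c := by
    rw [Test.Holds, h_value, hs.threshold]
  suffices Reaches O (.ite (.le Reg.value Reg.threshold) (moveAll Stk.assignment Stk.discard)
      swapProg) s (12 * n + 8)
      (SearchState l (if valueOf l d ≤ valueOf l c then c else d) w [] (j + 1)) from
    this.seq fun s' h _ => h.sub_rounds
  split_ifs with h_le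
  · exact (Draws.ite_true (h_test.2 h_le) (discardProg_reaches hs)).mono (by lia) fun _ _ h _ => h
  · exact Draws.ite_false (mt h_test.1 h_le) (swapProg_reaches hs h_value)

/-- Round the answer of the oracle to the assignment to be tried. -/
def readAnswerProg : Prog :=
  .seq (instrs [.copy Reg.varCount Reg.numVars]) <|
  .seq roundingLoop <|
  .seq (moveAll Stk.spare Stk.assignment) (instrs [.pop Reg.threshold Stk.word])

theorem readAnswerProg_reaches {R : ℕ} {g : Fin R → Fin n → Bool}
    (hs : SearchState l c (query (valueOf l c) g l) [] j s) :
    Reaches O readAnswerProg s (12 * n + 7)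
      (SearchState l c (hashWord g ++ l.flatMap App.encode)
        (bits (List.ofFn (toAssignment n (s.stk Stk.answer)))) j) := by
  set d := toAssignment n (s.stk Stk.answer)
  refine Reaches.mono (t := 1 + (8 * n + 1 + (4 * n + 1 + 1 + 1) + 1) + 1)
    ((Reaches.of_straight s).seq fun s₁ h₁ hF₁ =>
      ((roundingLoop_reaches (hs.toHasConstants.of_frame hF₁) (i := n) ?_).mono le_rfl
        fun s₂ h₂ _ => h₂.trans ?_).seq
        (A := fun s₂ => s₂.stk Stk.spare = (bits (List.ofFn d)).reverse) fun s₂ h₂ hF₂ =>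
      ((moveAll_reaches (by decide) s₂).mono ?_ fun _ h _ => h).seq fun s₃ h₃ hF₃ =>
      (Reaches.of_straight s₃).mono le_rfl fun s₄ h₄ hF₄ => ?_) (by lia) fun _ h _ => h
  · subst h₁
    simp [instrs, Prog.effect, Instr.exec, hs.numVars]
  · rw [hF₁.stk Stk.answer, hF₁.stk Stk.spare, hs.spare, List.append_nil]
  · simp [h₂, bits]
  have hF₁₃ := hF₁.seq (hF₂.seq hF₃)
  have hF := hF₁.seq (hF₂.seq (hF₃.seq hF₄))
  have h_word : s₃.stk Stk.word = query (valueOf l c) g l := (hF₁₃.stk _).trans hs.word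
  exact {
    toHasParams := hs.toHasParams.of_frame hF
    word := by simp [h₄, instrs, Prog.effect, Instr.exec, h_word, query]
    current := (hF.stk _).trans hs.current
    assignment := by
      rw [hF₄.stk Stk.assignment, h₃.2, h₂, List.reverse_reverse, (hF₁.seq hF₂).stk Stk.assignment,
        hs.assignment, List.append_nil]
    spare := (hF₄.stk _).trans h₃.1
    done := (hF.stk _).trans hs.done
    threshold := by simp [h₄, instrs, Prog.effect, Instr.exec, h_word, query]
    rounds := (hF.reg _).trans hs.rounds }

theorem SearchState.testProg_reaches {R : ℕ} {g : Fin R → Fin n → Bool}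
    (hs : SearchState l c (hashWord g ++ l.flatMap App.encode) (bits (List.ofFn d)) j s) :
    Reaches O testProg s ((18 * n + 87) * (R * (n + 1) + (l.flatMap App.encode).length) + 19)
      fun s' => s'.reg Reg.value = valueOf l d ∧
        SearchState l c (l.flatMap App.encode) (bits (List.ofFn d)) j s' := by
  refine (MaxProd.testProg_reaches g l d hs.toHasConstants hs.word hs.assignment hs.spare
    hs.done).mono le_rfl ?_
  rintro s' ⟨h_value, h_word, h_assignment, h_spare, h_done⟩ hF
  exact ⟨h_value, {
    toHasParams := hs.toHasParams.of_frame hF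
    word := h_word
    current := (hF.stk _).trans hs.current
    assignment := h_assignment
    spare := h_spare
    done := h_done
    threshold := (hF.reg _).trans hs.threshold
    rounds := (hF.reg _).trans hs.rounds }⟩

def answerProg : Prog := .seq readAnswerProg <| .seq testProg replaceProg

theorem answerProg_reaches {R : ℕ} {g : Fin R → Fin n → Bool}
    (hs : SearchState l c (query (valueOf l c) g l) [] (j + 1) s) :
    Reaches O answerProg s
      ((18 * n + 87) * (R * (n + 1) + (l.flatMap App.encode).length) + 24 * n + 38)
      (SearchState l (advance l c (s.stk Stk.answer)) (l.flatMap App.encode) [] j) :=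
  ((readAnswerProg_reaches hs).seq fun _ h₁ _ => h₁.testProg_reaches.seq fun _ h₂ _ =>
    replaceProg_reaches h₂.2 h₂.1).mono (by lia) fun _ _ h _ => h

def countChecks : Prog :=
  instrs [.copy Reg.checkCount Reg.numVars, .add Reg.checkCount Reg.checkCount Reg.one,
    .add Reg.checkCount Reg.checkCount Reg.one]

/-- Write a query with random parity checks. -/
def writeQueryProg : Prog :=
  .seq countChecks <| .seq hashLoop (instrs [.push Stk.word Reg.threshold])

/-- Ask the oracle for an improvement that passes random parity checks, and use the answer. -/
def roundProg : Prog := .seq writeQueryProg <| .seq (.query Stk.word Reg.half Stk.answer) answerProg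

theorem writeQueryProg_draws (hs : SearchState l c (l.flatMap App.encode) [] j s) :
    Draws O writeQueryProg s ((12 * n + 8) * (n + 2) + 9)
      (PMF.uniformOfFintype (Fin (n + 2) → Fin n → Bool))
      fun g => SearchState l c (query (valueOf l c) g l) [] j := by
  refine Draws.mono (t := 5 + ((12 * n + 8) * (n + 2) + 1 + 1 + 1) + 1)
    ((Reaches.of_straight s).seq fun s₁ h₁ hF₁ =>
      (hashLoop_draws (hs.toHasParams.of_frame hF₁) (R := n + 2) ?_).seq_reaches
        (S := fun g => SearchState l c (query (valueOf l c) g l) [] j) fun g s₂ h₂ hF₂ =>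
      (Reaches.of_straight s₂).mono le_rfl fun s₃ h₃ hF₃ => ?_) (by lia) fun _ _ h _ => h
  · subst h₁
    simp [countChecks, instrs, Prog.effect, Instr.exec, hs.numVars, hs.one, add_assoc,
      one_add_one_eq_two]
  have hF := hF₁.seq (hF₂.seq hF₃)
  have h_threshold := ((hF₁.seq hF₂).reg Reg.threshold).trans hs.threshold
  exact {
    toHasParams := hs.toHasParams.of_frame hF
    word := by
      simp [h₃, instrs, Prog.effect, Instr.exec, query, h_threshold, h₂, hF₁.stk Stk.word, hs.word]
    current := (hF.stk _).trans hs.current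
    assignment := (hF.stk _).trans hs.assignment
    spare := (hF.stk _).trans hs.spare
    done := (hF.stk _).trans hs.done
    threshold := (hF.reg _).trans hs.threshold
    rounds := (hF.reg _).trans hs.rounds }

theorem SearchState.query_draws (hs : SearchState l c w [] j s) :
    Draws O (.query Stk.word Reg.half Stk.answer) s 1 (O w (1 / 2)) fun z s' =>
      s'.stk Stk.answer = z ∧ SearchState l c w [] j s' := by
  rw [← hs.word]
  refine (Draws.query hs.half).mono le_rfl fun z s' h hF => ⟨by simp [h], {
    toHasParams := hs.toHasParams.of_frame hF
    word := hF.stk _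
    current := (hF.stk _).trans hs.current
    assignment := (hF.stk _).trans hs.assignment
    spare := (hF.stk _).trans hs.spare
    done := (hF.stk _).trans hs.done
    threshold := (hF.reg _).trans hs.threshold
    rounds := (hF.reg _).trans hs.rounds }⟩

/-- A bound on the running time of a round with `n` variables and `w` further entries.  It is read
both as a number and as a polynomial. -/
def roundTime {A : Type*} [CommSemiring A] (n w : A) : A :=
  (18 * n + 87) * ((n + 2) * (n + 1) + w) + (12 * n + 8) * (n + 2) + 24 * n + 50

theorem roundProg_draws (hs : SearchState l c (l.flatMap App.encode) [] (j + 1) s) :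
    Draws O roundProg s (roundTime n (l.flatMap App.encode).length) (roundDist O l c)
      fun d => SearchState l d (l.flatMap App.encode) [] j := by
  refine ((writeQueryProg_draws hs).seq fun g s₁ h₁ _ => Draws.map
    (h₁.query_draws.seq_reaches fun z s₂ h₂ _ => ?_)).mono
      (t := (12 * n + 8) * (n + 2) + 9 + (1 + ((18 * n + 87) * ((n + 2) * (n + 1) +
        (l.flatMap App.encode).length) + 24 * n + 38) + 1) + 1) ?_ fun _ _ h _ => h
  · obtain ⟨rfl, h₂⟩ := h₂
    exact answerProg_reaches h₂
  · rw [roundTime]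
    lia

/-- Repeat the rounds. -/
def roundLoop : Prog := .loop (.le Reg.one Reg.rounds) roundProg

theorem roundLoop_draws {k : ℕ} (hs : SearchState l c (l.flatMap App.encode) [] k s) :
    Draws O roundLoop s (k * (roundTime n (l.flatMap App.encode).length + 1) + 1)
      (searchDist O l k c) fun d => SearchState l d (l.flatMap App.encode) [] 0 := by
  induction k generalizing c s with
  | zero =>
    have h_end : ¬ (Test.le Reg.one Reg.rounds).Holds s := by
      simp [hs.le_one_holds_iff hs.rounds]
    refine Reaches.draws ((Reaches.loop_false h_end).mono (by lia) ?_)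
    rintro _ rfl -
    simpa using hs
  | succ k ih =>
    rw [Nat.cast_succ] at hs
    have h_round : (Test.le Reg.one Reg.rounds).Holds s := by
      simp [Test.Holds, hs.one, hs.rounds]
    exact ((roundProg_draws hs).loop_true h_round fun d s' h _ => ih h).mono (by lia)
      fun _ _ h _ => h

def startProg : Prog :=
  instrs [.const Reg.zero 0, .const Reg.one 1, .const Reg.half (1 / 2),
    .const Reg.marker (-(1 / 2)), .pop Reg.entry Stk.word]

def stripBody : Prog :=
  instrs [.push Stk.current Reg.zero, .push Stk.assignment Reg.zero,
    .add Reg.numVars Reg.numVars Reg.one, .pop Reg.entry Stk.word]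

/-- Remove the number of variables from the word and write the zero assignment. -/
def stripLoop : Prog := .loop (.le Reg.one Reg.entry) stripBody

theorem stripBody_reaches (hs : s.HasConstants) :
    Reaches O stripBody s 7 fun s' =>
      s'.reg Reg.numVars = s.reg Reg.numVars + 1 ∧
      s'.reg Reg.entry = (s.stk Stk.word).headD 0 ∧ s'.stk Stk.word = (s.stk Stk.word).tail ∧
      s'.stk Stk.current = 0 :: s.stk Stk.current ∧
      s'.stk Stk.assignment = 0 :: s.stk Stk.assignment := by
  have h_nodes : stripBody.nodes = 7 := rfl
  refine (Reaches.of_straight s).mono h_nodes.le ?_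
  rintro _ rfl -
  simp [stripBody, instrs, Prog.effect, Instr.exec, hs.zero, hs.one]

theorem stripLoop_reaches (hs : s.HasConstants)
    (h : s.reg Reg.entry :: s.stk Stk.word = List.replicate n 1 ++ 0 :: w) :
    Reaches O stripLoop s (8 * n + 1) fun s' =>
      s'.reg Reg.numVars = s.reg Reg.numVars + n ∧ s'.stk Stk.word = w ∧
      s'.stk Stk.current = List.replicate n 0 ++ s.stk Stk.current ∧
      s'.stk Stk.assignment = List.replicate n 0 ++ s.stk Stk.assignment := by
  induction n generalizing s with
  | zero =>
    rw [List.replicate_zero, List.nil_append, List.cons.injEq] at h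
    refine (Reaches.loop_false (by simp [Test.Holds, hs.one, h.1])).mono le_rfl ?_
    rintro _ rfl -
    simp [h.2]
  | succ n ih =>
    rw [List.replicate_succ, List.cons_append, List.cons.injEq] at h
    refine (Reaches.loop_true (by simp [Test.Holds, hs.one, h.1]) (stripBody_reaches hs)
      fun s' h' hF => (ih (hs.of_frame hF) ?_).mono le_rfl fun s'' h'' _ => ?_).mono (by lia)
        fun _ _ h _ => h
    · rw [h'.2.1, h'.2.2.1, h.2]
      cases n <;> simp [List.replicate_succ]
    · rw [h''.1, h''.2.1, h''.2.2.1, h''.2.2.2, h'.1, h'.2.2.2.1, h'.2.2.2.2]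
      simp [List.replicate_succ', add_assoc, add_comm]

/-- Write the constants and the zero assignment, and remove the number of variables from the
word. -/
def unpackProg : Prog := .seq startProg stripLoop

theorem unpackProg_reaches (w : List ℝ) (ε : ℝ) :
    Reaches O unpackProg (load (List.replicate n 1 ++ 0 :: w) [] ε) (8 * n + 11) fun s =>
      s.HasParams n ∧ s.stk Stk.word = w ∧
      s.stk Stk.current = bits (List.ofFn fun _ : Fin n => false) ∧
      s.stk Stk.assignment = bits (List.ofFn fun _ : Fin n => false) ∧
      s.stk Stk.spare = [] ∧ s.stk Stk.done = [] := by
  have h_nodes : startProg.nodes = 9 := rfl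
  refine ((Reaches.of_straight _).seq fun s₁ h₁ hF₁ =>
    (stripLoop_reaches (n := n) (w := w) ⟨?_, ?_⟩ ?_).mono (u := 8 * n + 1) le_rfl
      fun s₂ h₂ hF₂ => ?_).mono (by lia) fun _ _ h _ => h
  · simp [h₁, startProg, instrs, Prog.effect, Instr.exec]
  · simp [h₁, startProg, instrs, Prog.effect, Instr.exec]
  · cases n <;> simp [h₁, startProg, instrs, Prog.effect, Instr.exec, load, List.replicate_succ]
  · have h_zeros : bits (List.replicate n false) = List.replicate n 0 := by
      simp [bits]
    obtain ⟨h_numVars, h_word, h_current, h_assignment⟩ := h₂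
    have hF := hF₁.seq hF₂
    refine ⟨⟨⟨?_, ?_⟩, ?_, ?_, ?_⟩, h_word, ?_, ?_, hF.stk _, hF.stk _⟩
    · simp [hF₂.reg Reg.zero, h₁, startProg, instrs, Prog.effect, Instr.exec]
    · simp [hF₂.reg Reg.one, h₁, startProg, instrs, Prog.effect, Instr.exec]
    · simp [h_numVars, h₁, startProg, instrs, Prog.effect, Instr.exec, load]
    · simp [hF₂.reg Reg.half, h₁, startProg, instrs, Prog.effect, Instr.exec]
    · simp [hF₂.reg Reg.marker, h₁, startProg, instrs, Prog.effect, Instr.exec]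
    · simp [h_current, h_zeros, hF₁.stk Stk.current, load]
    · simp [h_assignment, h_zeros, hF₁.stk Stk.assignment, load]

def countRounds : Prog :=
  instrs [.copy Reg.threshold Reg.value, .add Reg.rounds Reg.numVars Reg.one,
    .add Reg.rounds Reg.rounds Reg.one, .const Reg.scratch 16,
    .mul Reg.rounds Reg.rounds Reg.scratch]

/-- Take the zero assignment as the current one. -/
def prepareProg : Prog :=
  .seq unpackProg <| .seq testProg <| .seq countRounds (moveAll Stk.assignment Stk.discard)

theorem prepareProg_reaches (l : List (App n)) (ε : ℝ) :
    Reaches O prepareProg (load (List.replicate n 1 ++ 0 :: l.flatMap App.encode) [] ε)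
      ((18 * n + 87) * (l.flatMap App.encode).length + 12 * n + 43)
      (SearchState l (fun _ => false) (l.flatMap App.encode) [] (16 * (n + 2) : ℕ)) := by
  have h_nodes : countRounds.nodes = 9 := rfl
  have h_no_checks : hashWord (R := 0) (n := n) Fin.elim0 = [] := by simp [hashWord]
  refine ((unpackProg_reaches _ ε).seq fun s₁ ⟨h_params, h_word, h_current, h_assignment,
      h_spare, h_done⟩ _ =>
    (testProg_reaches (R := 0) Fin.elim0 l (fun _ => false) h_params.toHasConstants
      (by rw [h_word, h_no_checks, List.nil_append]) h_assignment h_spare h_done).seq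
    fun s₂ ⟨h_value, h_word₂, h_assignment₂, h_spare₂, h_done₂⟩ hF₂ =>
    (Reaches.of_straight s₂).seq fun s₃ h₃ hF₃ =>
    discardProg_reaches (d := fun _ => false) ?_).mono (by lia) fun _ _ h _ => h
  have hF := hF₂.seq hF₃
  exact {
    toHasParams := h_params.of_frame hF
    word := (hF₃.stk _).trans h_word₂
    current := (hF.stk _).trans h_current
    assignment := (hF₃.stk _).trans h_assignment₂
    spare := (hF₃.stk _).trans h_spare₂
    done := (hF₃.stk _).trans h_done₂
    threshold := by simp [h₃, countRounds, instrs, Prog.effect, Instr.exec, h_value]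
    rounds := by
      simp [h₃, countRounds, instrs, Prog.effect, Instr.exec, hF₂.reg Reg.numVars,
        h_params.numVars, hF₂.reg Reg.one, h_params.one]
      ring }

/-- Search for an optimal assignment with the help of the oracle. -/
def searchProg : Prog := .seq prepareProg roundLoop

/-- A bound on the running time of the search, read like `roundTime`. -/
def searchTime {A : Type*} [CommSemiring A] (n w : A) : A :=
  16 * (n + 2) * (roundTime n w + 1) + (18 * n + 87) * w + 12 * n + 45

theorem searchProg_draws (l : List (App n)) (ε : ℝ) :
    Draws O searchProg (load (List.replicate n 1 ++ 0 :: l.flatMap App.encode) [] ε)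
      (searchTime n (l.flatMap App.encode).length)
      (searchDist O l (16 * (n + 2)) fun _ => false)
      fun c s => s.stk Stk.current = bits (List.ofFn c) := by
  refine ((prepareProg_reaches l ε).seq fun s hs _ => roundLoop_draws hs).mono ?_
    fun c s h _ => h.current
  rw [searchTime]
  lia

end SearchProgram

/-! ## Correctness of the reduction -/

theorem CSPInst.coe_value {F : Set Constraint} (X : CSPInst F) (y : List Bool) :
    (X.value y : ℝ) = valueOf X.apps fun i => y.getD i false := by
  rw [CSPInst.value, valueOf, NNReal.coe_list_prod, List.map_map]
  rfl

theorem CSPInst.length_encode {F : Set Constraint} (X : CSPInst F) :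
    X.encode.length = X.numVars + (X.apps.flatMap App.encode).length + 1 := by
  rw [CSPInst.encode, List.length_append, List.length_replicate, List.length_cons, add_assoc]

theorem isApprox_of_forall_valueOf_le {F : Set Constraint} (X : CSPInst F)
    {c : Fin X.numVars → Bool} (hc : ∀ d, valueOf X.apps d ≤ valueOf X.apps c) {r : ℝ}
    (hr : 1 ≤ r) : (maxProdCSP F).IsApprox r X (List.ofFn c) := by
  have h_sol : List.ofFn c ∈ (maxProdCSP F).sol X := List.length_ofFn
  have h_value : (X.value (List.ofFn c) : ℝ) = valueOf X.apps c := by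
    simp [CSPInst.coe_value]
  refine ⟨h_sol, List.ofFn c, ⟨h_sol, fun z _ => ?_⟩, id, fun h => ?_⟩
  · change X.value z ≤ X.value (List.ofFn c)
    rw [← NNReal.coe_le_coe, h_value, CSPInst.coe_value]
    exact hc _
  · rw [div_self (NNReal.coe_ne_zero.2 h), abs_one]
    exact ⟨(div_le_one (by linarith)).2 hr, hr⟩

theorem searchTime_mono {n n' w w' : ℕ} (hn : n ≤ n') (hw : w ≤ w') :
    searchTime n w ≤ searchTime n' w' := by
  unfold searchTime roundTime
  gcongr

theorem searchTime_le_floor_polyVal {F : Set Constraint} (X : CSPInst F) (ε : ℝ) :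
    searchTime X.numVars (X.apps.flatMap App.encode).length ≤
      ⌊(maxProdCSP F).polyVal (searchTime (MvPolynomial.X 0) (MvPolynomial.X 0)) X ε⌋₊ := by
  have h_size : (maxProdCSP F).size X = X.encode.length := rfl
  have h_eval : (maxProdCSP F).polyVal (searchTime (MvPolynomial.X 0) (MvPolynomial.X 0)) X ε =
      ((searchTime X.encode.length X.encode.length : ℕ) : ℝ) := by
    simp [OptProblem.polyVal, searchTime, roundTime, h_size]
  have h_length := X.length_encode
  rw [h_eval, Nat.floor_natCast]
  exact searchTime_mono (by lia) (by lia)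

theorem maxProdCSP_reduces (F : Set Constraint) : (maxProdCSP F).APTReduces improvement := by
  refine ⟨searchProg, 2, searchTime (MvPolynomial.X 0) (MvPolynomial.X 0), fun O hO => ?_⟩
  have h_draws (X : CSPInst F) (ε : ℝ) :=
    (searchProg_draws (O := O) X.apps ε).mono (searchTime_le_floor_polyVal X ε) fun _ _ h _ => h
  refine ⟨fun X ε hε _ => ?_,
    fun X ε _ _ => ⟨fun t c hc k d a K hK => ?_, (h_draws X ε).haltsWithin⟩⟩
  · rw [PMF.toOuterMeasure_map_apply]
    refine (three_quarters_le_searchDist hO).trans ((h_draws X ε).toOuterMeasure_le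
      (B := {s | ∃ y, s.stk 1 = bits y ∧ (maxProdCSP F).IsApprox ((2 : ℝ) ^ ε) X y})
      fun c s hc hs => ⟨_, hs, isApprox_of_forall_valueOf_le X hc ?_⟩)
    exact Real.one_le_rpow one_le_two hε.le
  · rw [(h_draws X ε).tolerance_eq_half hc hK]
    exact ⟨⟨c.store.stk k, rfl⟩, by norm_num, by norm_num, by simp [OptProblem.polyVal]⟩

end MaxProd

end

theorem mainTheorem10 (F : Set MaxProd.Constraint) :
    (MaxProd.maxProdCSP F).APTReducesToClass MaxProd.OptProblem.EXPAPX :=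
  ⟨MaxProd.improvement, MaxProd.improvement_mem_EXPAPX, MaxProd.maxProdCSP_reduces F⟩
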